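/- Let $N\ge 1$ be an integer, let $d\omega$ be the surface measure on the unit sphere $S^{N-1}\subset\mathbb R^N$ (counting measure on the two points if $N=1$), and normalize the Fourier transform on $\mathcal S'(\mathbb R^N)$ by $(\mathcal F f)(Y)=\int_{\mathbb R^N} f(X)e^{-2\pi i\langle X,Y\rangle}\,dX$. For $\nu\in\mathbb C$ put $$V_\nu=\{f\in C^\infty(\mathbb R^N\setminus\{0\}) : f(tX)=|t|^{-\nu-N/2}f(X)\ \text{ for all } t\in\mathbb R\setminus\{0\}\},$$ which is identified, by restriction to the sphere, with the space $C^\infty_{\rm even}(S^{N-1})$ of smooth even functions on $S^{N-1}$; for $h$ in the latter space let $h^{(\nu)}\in V_\nu$ be the homogeneous extension $h^{(\nu)}(r\omega)=r^{-\nu-N/2}h(\omega)$ ($r>0$). (a) For $\operatorname{Re}\mu<1-\frac N2$, $h\in C^\infty(S^{N-1})$ and $\eta\in S^{N-1}$ the integral $$(\mathcal Q_\mu h)(\eta)=\int_{S^{N-1}}|\langle\omega,\eta\rangle|^{-\mu-N/2}\,h(\omega)\,d\omega$$ converges absolutely. It extends to a family of linear operators $\mathcal Q_\mu:C^\infty(S^{N-1})\to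 C^\infty_{\rm even}(S^{N-1})$ that is meromorphic in $\mu\in\mathbb C$ (that is, $(\mathcal Q_\mu h)(\eta)$ is meromorphic in $\mu$ for all $h$ and $\eta$), with at most simple poles, contained in $P=\{1-\frac N2,\,3-\frac N2,\,5-\frac N2,\dots\}$. (b) For $\operatorname{Re}\nu<\frac N2$ the elements of $V_\nu$ are locally integrable and define tempered distributions by integration. For $h\in C^\infty_{\rm even}(S^{N-1})$ the distribution $h^{(\nu)}$ extends to a tempered distribution depending meromorphically on $\nu\in\mathbb C$ (that is, its pairing with each Schwartz function is meromorphic in $\nu$), with at most simple poles, contained in $R=\{\frac N2,\,\frac N2+2,\,\frac N2+4,\dots\}$. In this way $V_\nu$ is mapped linearly into $\mathcal S'(\mathbb R^N)$ for $\nu\notin R$. (c) Let $$C_N(\mu)=\frac{2\,\pi^{\mu+\frac{N-1}{2}}\,\Gamma\!\left(\frac{2-N-2\mu}{4}\right)}{\Gamma\!\left(\frac{N+2\mu}{4}\right)} .$$ Then, as a meromorphic identity in $\mu$, $$\mathcal Q_\mu=C_N(\mu)\,\mathcal F\big|_{V_{-\mu}} .$$ Precisely, let $\mu\in\mathbb C$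 with $\mu\notin P$ and $-\mu\notin R$, and let $h\in C^\infty_{\rm even}(S^{N-1})$. Then $$(\mathcal Q_\mu h)^{(\mu)}=C_N(\mu)\,\mathcal F\big(h^{(-\mu)}\big)$$ as distributions on $\mathbb R^N\setminus\{0\}$ (also when tested against Schwartz functions that vanish near $0$, the product of $(\mathcal Q_\mu h)^{(\mu)}$ with such a function being integrable); if moreover $\mu\notin R$, the identity holds in $\mathcal S'(\mathbb R^N)$. -/

import Mathlib

open scoped SchwartzMap FourierTransform Manifold ContDiff
open MeasureTheory Metric

namespace HomogeneousFourier

/-- The Euclidean space `ℝ^N` with `N = n + 1`; thus `N` is an arbitrary positive integer. -/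
abbrev E (n : ℕ) : Type := EuclideanSpace ℝ (Fin (n + 1))

/-- The unit sphere `S^{N-1}` in `ℝ^N`, `N = n + 1` (two points when `N = 1`). -/
abbrev S (n : ℕ) : Type := sphere (0 : E n) 1

instance factFinrank (n : ℕ) : Fact (Module.finrank ℝ (E n) = n + 1) :=
  ⟨finrank_euclideanSpace_fin⟩

/-- `C^∞(S^{N-1})`, the complex-valued smooth functions on the sphere. -/
def smooth (n : ℕ) : Submodule ℂ (S n → ℂ) where
  carrier := {h | ContMDiff (𝓡 n) 𝓘(ℝ, ℂ) ∞ h}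
  add_mem' hf hg := ContMDiff.add hf hg
  zero_mem' := contMDiff_const
  smul_mem' c _ hf :=
    ((c • ContinuousLinearMap.id ℝ ℂ : ℂ →L[ℝ] ℂ).contMDiff).comp hf

/-- The smooth even functions on the sphere. -/
def smoothEven (n : ℕ) : Submodule ℂ (smooth n) where
  carrier := {h | ∀ σ : S n, h.1 (-σ) = h.1 σ}
  add_mem' hf hg σ := by simp [hf σ, hg σ]
  zero_mem' σ := by simp
  smul_mem' c f hf σ := by simp [hf σ]

/-- The degree of homogeneity `-ν - N/2` of the elements of `V_ν`. -/
noncomputable def deg (n : ℕ) (ν : ℂ) : ℂ := -ν - ((n + 1 : ℕ) : ℂ) / 2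

/-- `V_ν`: the functions `f ∈ C^∞(ℝ^N ∖ {0})` with `f (t X) = |t|^{-ν-N/2} f X` for all real
`t ≠ 0`. Such a function is stored as a function on `ℝ^N` that takes the value `0` at the
origin. -/
def V (n : ℕ) (ν : ℂ) : Submodule ℂ (E n → ℂ) where
  carrier := {f | ContDiffOn ℝ ∞ f {0}ᶜ ∧ f 0 = 0 ∧
    ∀ (t : ℝ) (x : E n), t ≠ 0 → x ≠ 0 → f (t • x) = ((|t| : ℝ) : ℂ) ^ deg n ν * f x}
  add_mem' := by
    rintro f g ⟨h1, h2, h3⟩ ⟨k1, k2, k3⟩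
    refine ⟨h1.add k1, by simp [h2, k2], fun t x ht hx => ?_⟩
    simp only [Pi.add_apply, h3 t x ht hx, k3 t x ht hx]
    ring
  zero_mem' := ⟨contDiffOn_const, rfl, by simp⟩
  smul_mem' := by
    rintro c f ⟨h1, h2, h3⟩
    refine ⟨h1.const_smul c, by simp [h2], fun t x ht hx => ?_⟩
    simp only [Pi.smul_apply, h3 t x ht hx, smul_eq_mul]
    ring

/-- The point `x / |x|` of the sphere, for `x ≠ 0`. -/
noncomputable def dir {n : ℕ} (x : E n) (hx : x ≠ 0) : S n :=
  ⟨‖x‖⁻¹ • x, by simp [norm_smul, hx]⟩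

open Classical in
/-- The homogeneous extension `r σ ↦ r ^ (-ν - N/2) h(σ)` (`r > 0`, `σ ∈ S^{N-1}`). -/
noncomputable def homExt {n : ℕ} (ν : ℂ) (h : S n → ℂ) (x : E n) : ℂ :=
  if hx : x = 0 then 0 else ((‖x‖ : ℝ) : ℂ) ^ deg n ν * h (dir x hx)

theorem homExt_contDiffAt {n : ℕ} (ν : ℂ) (h : smooth n) (x : E n) (hx : x ≠ 0) :
    ContDiffAt ℝ ∞ (homExt ν h.1) x := by
  let U : TopologicalSpace.Opens (E n) := ⟨{0}ᶜ, isOpen_compl_singleton⟩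
  have hU : ∀ y : U, (y : E n) ≠ 0 := fun y => y.2
  have hn : ContMDiff 𝓘(ℝ, E n) 𝓘(ℝ, E n) ∞ (fun y : U => ‖(y : E n)‖⁻¹ • (y : E n)) := by
    intro y
    have hy : ContDiffAt ℝ ∞ (fun z : E n => ‖z‖⁻¹ • z) (y : E n) :=
      ((contDiffAt_norm ℝ (hU y)).inv (norm_ne_zero_iff.2 (hU y))).smul contDiffAt_id
    exact hy.contMDiffAt.comp y (contMDiff_subtype_val y)
  have hd : ContMDiff 𝓘(ℝ, E n) 𝓘(ℝ, ℂ) ∞ (fun y : U => h.1 (dir (y : E n) (hU y))) :=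
    ContMDiff.comp (g := h.1) (I' := 𝓡 n) h.2
      (hn.codRestrict_sphere (n := n) (fun y => by simp [norm_smul, hU y]))
  have hp : ContMDiff 𝓘(ℝ, E n) 𝓘(ℝ, ℂ) ∞
      (fun y : U => ((‖(y : E n)‖ : ℝ) : ℂ) ^ deg n ν) := by
    intro y
    have h1 : ContDiffAt ℝ ∞ (fun z : E n => Complex.exp (((Real.log ‖z‖ : ℝ) : ℂ) * deg n ν))
        (y : E n) := by
      have h2 : ContDiffAt ℝ ∞ (fun z : E n => Real.log ‖z‖) (y : E n) :=
        (contDiffAt_norm ℝ (hU y)).log (norm_ne_zero_iff.2 (hU y))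
      exact ((Complex.ofRealCLM.contDiff.contDiffAt.comp (y : E n) h2).mul
        contDiffAt_const).cexp
    have h3 : ContMDiffAt 𝓘(ℝ, E n) 𝓘(ℝ, ℂ) ∞
        (fun z : U => Complex.exp (((Real.log ‖(z : E n)‖ : ℝ) : ℂ) * deg n ν)) y :=
      h1.contMDiffAt.comp y (contMDiff_subtype_val y)
    refine h3.congr_of_eventuallyEq (Filter.Eventually.of_forall fun z => ?_)
    have hz : ((‖(z : E n)‖ : ℝ) : ℂ) ≠ 0 :=
      Complex.ofReal_ne_zero.2 (norm_ne_zero_iff.2 (hU z))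
    simp only [Complex.cpow_def_of_ne_zero hz, Complex.ofReal_log (norm_nonneg _)]
  have ht : ContMDiffAt 𝓘(ℝ, E n) 𝓘(ℝ, ℂ) ∞ (fun y : U => homExt ν h.1 (y : E n)) ⟨x, hx⟩ := by
    have he : (fun y : U => homExt ν h.1 (y : E n)) = fun y : U =>
        (ContinuousLinearMap.mul ℝ ℂ) (((‖(y : E n)‖ : ℝ) : ℂ) ^ deg n ν)
          (h.1 (dir (y : E n) (hU y))) := by
      funext y
      simp [homExt, hU y]
    rw [he]
    have hb : ContDiff ℝ ∞ (fun p : ℂ × ℂ => (ContinuousLinearMap.mul ℝ ℂ) p.1 p.2) := by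
      simpa using contDiff_fst.mul contDiff_snd
    exact hb.contMDiff.contMDiffAt.comp (⟨x, hx⟩ : U) ((hp _).prodMk_space (hd _))
  exact (contMDiffAt_subtype_iff.1 ht).contDiffAt

theorem homExt_mem {n : ℕ} (ν : ℂ) (h : smoothEven n) : homExt ν h.1.1 ∈ V n ν := by
  refine ⟨fun x hx => (homExt_contDiffAt ν h.1 x hx).contDiffWithinAt, by simp [homExt],
    fun t x ht hx => ?_⟩
  have htx : t • x ≠ 0 := smul_ne_zero ht hx
  have hd : h.1.1 (dir (t • x) htx) = h.1.1 (dir x hx) := by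
    rcases lt_or_gt_of_ne ht with h1 | h1
    · rw [← h.2 (dir x hx)]
      refine congrArg h.1.1 (Subtype.ext ?_)
      simp only [dir, norm_smul, Real.norm_eq_abs, abs_of_neg h1, smul_smul, mul_inv,
        coe_neg_sphere, ← neg_smul]
      congr 1
      field_simp
    · refine congrArg h.1.1 (Subtype.ext ?_)
      simp only [dir, norm_smul, Real.norm_eq_abs, abs_of_pos h1, smul_smul, mul_inv]
      congr 1
      field_simp
  simp only [homExt, htx, hx, dif_neg, not_false_eq_true, hd, norm_smul, Real.norm_eq_abs,
    Complex.ofReal_mul]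
  rw [Complex.mul_cpow_ofReal_nonneg (abs_nonneg t) (norm_nonneg x), mul_assoc]

theorem restrict_mem {n : ℕ} (ν : ℂ) {f : E n → ℂ} (hf : f ∈ V n ν) :
    (fun σ : S n => f σ) ∈ smooth n := by
  intro σ
  have h0 : (σ : E n) ≠ 0 := ne_zero_of_mem_unit_sphere σ
  have h1 : ContDiffAt ℝ ∞ f (σ : E n) :=
    (hf.1 σ h0).contDiffAt (isOpen_compl_singleton.mem_nhds h0)
  exact h1.contMDiffAt.comp σ (contMDiff_coe_sphere (n := n) σ)

theorem restrict_even {n : ℕ} (ν : ℂ) {f : E n → ℂ} (hf : f ∈ V n ν) (σ : S n) :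
    f ((-σ : S n) : E n) = f σ := by
  have h0 : (σ : E n) ≠ 0 := ne_zero_of_mem_unit_sphere σ
  simpa using hf.2.2 (-1) σ (by norm_num) h0

/-- The identification of the smooth even functions on the sphere with `V_ν`; its inverse is the
restriction to the sphere. -/
noncomputable def ext (n : ℕ) (ν : ℂ) : smoothEven n ≃ₗ[ℂ] V n ν where
  toFun h := ⟨homExt ν h.1.1, homExt_mem ν h⟩
  map_add' h k := by
    ext x
    by_cases hx : x = 0 <;> simp [homExt, hx, mul_add]
  map_smul' c h := by
    ext x
    by_cases hx : x = 0 <;> simp [homExt, hx, mul_left_comm]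
  invFun f := ⟨⟨fun σ => f.1 σ, restrict_mem ν f.2⟩, restrict_even ν f.2⟩
  left_inv h := by
    ext σ
    have h0 : (σ : E n) ≠ 0 := ne_zero_of_mem_unit_sphere σ
    simp [homExt, h0, dir]
  right_inv f := by
    ext x
    by_cases hx : x = 0
    · simp [homExt, hx, f.2.2.1]
    · have h1 : ‖x‖ ≠ 0 := norm_ne_zero_iff.2 hx
      have h2 := f.2.2.2 ‖x‖ (‖x‖⁻¹ • x) h1 (by simp [hx])
      rw [smul_smul, mul_inv_cancel₀ h1, one_smul, abs_norm] at h2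
      simp [homExt, hx, dir, h2]

/-- A function `F` of a complex variable is meromorphic on `ℂ`, its poles are at most simple, and
`F` is holomorphic at every point outside `A`. The values of `F` on `A` are irrelevant. -/
def MeromorphicSimplePolesIn (A : Set ℂ) (F : ℂ → ℂ) : Prop :=
  (∀ μ ∉ A, AnalyticAt ℂ F μ) ∧ ∀ μ ∈ A, MeromorphicAt F μ ∧ -1 ≤ meromorphicOrderAt F μ

/-- The possible poles `1 - N/2, 3 - N/2, 5 - N/2, …` of `Q_μ`. -/
def polesQ (n : ℕ) : Set ℂ :=
  {μ | ∃ j : ℕ, μ = 1 + 2 * (j : ℂ) - ((n + 1 : ℕ) : ℂ) / 2}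

/-- The parameters `N/2, N/2 + 2, N/2 + 4, …`, for which `V_ν` is not regarded as a space of
tempered distributions. -/
def polesV (n : ℕ) : Set ℂ :=
  {ν | ∃ j : ℕ, ν = ((n + 1 : ℕ) : ℂ) / 2 + 2 * (j : ℂ)}

/-- `Q` is the family of operators `Q_μ` on `C^∞(S^{N-1})` with kernel `|⟨σ, η⟩| ^ (-μ - N/2)`:
it is given by the absolutely convergent integral over the sphere (with its surface measure) for
`Re μ < 1 - N/2`, and by meromorphic continuation in `μ` elsewhere, the poles being simple and
contained in `polesQ n`. (The functions `Q_μ h` are even.) -/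
structure IsKernelFamily (n : ℕ) (Q : ℂ → smooth n →ₗ[ℂ] smoothEven n) : Prop where
  integrable : ∀ (μ : ℂ), μ.re < 1 - ((n + 1 : ℕ) : ℝ) / 2 → ∀ (h : smooth n) (η : S n),
    Integrable (fun σ : S n => ((|inner ℝ (σ : E n) (η : E n)| : ℝ) : ℂ) ^ deg n μ * h.1 σ)
      (volume : Measure (E n)).toSphere
  eq_integral : ∀ (μ : ℂ), μ.re < 1 - ((n + 1 : ℕ) : ℝ) / 2 → ∀ (h : smooth n) (η : S n),
    (Q μ h).1.1 η = ∫ σ : S n, ((|inner ℝ (σ : E n) (η : E n)| : ℝ) : ℂ) ^ deg n μ * h.1 σ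
      ∂(volume : Measure (E n)).toSphere
  meromorphic : ∀ (h : smooth n) (η : S n),
    MeromorphicSimplePolesIn (polesQ n) (fun μ => (Q μ h).1.1 η)

/-- `ι` is the family of maps `V_ν → 𝓢'(ℝ^N)` by which the elements of `V_ν` are regarded as
tempered distributions: for `Re ν < N/2` these functions are locally integrable and `ι ν f` is
integration against `f`; for other `ν` the distribution is obtained by meromorphic continuation
in `ν`, the function on the sphere being kept fixed. The poles are simple and contained in
`polesV n`. -/
structure IsDistributionFamily (n : ℕ) (ι : ∀ ν : ℂ, V n ν →ₗ[ℂ] 𝓢'(E n, ℂ)) : Prop where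
  integrable : ∀ (ν : ℂ), ν.re < ((n + 1 : ℕ) : ℝ) / 2 → ∀ (f : V n ν) (φ : 𝓢(E n, ℂ)),
    Integrable (fun x : E n => f.1 x * φ x)
  eq_integral : ∀ (ν : ℂ), ν.re < ((n + 1 : ℕ) : ℝ) / 2 → ∀ (f : V n ν) (φ : 𝓢(E n, ℂ)),
    ι ν f φ = ∫ x : E n, f.1 x * φ x
  meromorphic : ∀ (h : smoothEven n) (φ : 𝓢(E n, ℂ)),
    MeromorphicSimplePolesIn (polesV n) (fun ν => ι ν (ext n ν h) φ)

/-- The constant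
`C_N(μ) = 2 π^{μ + (N-1)/2} Γ((2 - N - 2μ)/4) / Γ((N + 2μ)/4)`, with `N = n + 1`. (Where the
denominator has a pole, both `C_N` and the quotient below vanish.) -/
noncomputable def C (n : ℕ) (μ : ℂ) : ℂ :=
  2 * (Real.pi : ℂ) ^ (μ + (((n + 1 : ℕ) : ℂ) - 1) / 2) *
    Complex.Gamma ((2 - ((n + 1 : ℕ) : ℂ) - 2 * μ) / 4) /
      Complex.Gamma ((((n + 1 : ℕ) : ℂ) + 2 * μ) / 4)

end HomogeneousFourier

/-!
Write `a = μ + N/2 = -deg n μ`, so that the kernel of `Q_μ` is `|⟨σ, η⟩| ^ (-a)`.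

**The strip `0 < Re a < 1`.** Here every integral converges absolutely. In one variable the Fourier
transform of `|t| ^ (-a)` is a multiple of `|r| ^ (a - 1)`. In the form needed here, for a Schwartz
function `H` on `ℝ^N` and a direction `η`, this says that `∫ |⟨x, η⟩| ^ (-a) H(x) dx` is
`C_N(μ) / 2` times the integral of `|r| ^ (a - 1) (𝓕 H)(r η)` over the line spanned by `η`
(`integral_kernel_eq_fourier`); both sides are superpositions of Gaussians, and a Gaussian in the
variable `⟨x, η⟩` is carried to a Gaussian on that line. Integrating against `h(η)` over the sphere
and using polar coordinates on the Fourier side gives the identity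
(`integral_homExt_kernelIntegral`).

**Continuation of `Q_μ`.** Take for `H` the function `χ(|x|) h(x/|x|)`, times a power of `|x|`, with
`χ` a bump function on the half-line. On the left the radial integral splits off, leaving `Q_μ h` up
to a scalar which does not vanish near a given `μ`. On the right stand Mellin transforms of a
Schwartz function along rays, which are smooth in `η` and holomorphic in `μ` for `Re a > 0`. Hence
the poles of `Q_μ h` are among the poles of `C_N`, which are simple (`kernelFamily`,
`isKernelFamily_kernelFamily`).

**Continuation of the distributions.** For `Re ν < N/2` the distribution is an integral. In the
strip the identity expresses it by `(C_N(-ν))⁻¹` and the inverse Fourier transform of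
`(Q_{-ν} h)^(-ν)`, and this formula makes sense for all `Re ν > N/2 - 1`. The poles are among those
of `(C_N(-ν))⁻¹` (`distFamily`, `isDistributionFamily_distFamily`).

**The identity.** The exceptional parameters form a countable set, whose complement is connected.
So the two continuations are unique, and the identity extends from the strip to all other
parameters. In `(Q_μ h)^(μ)` both the degree of homogeneity and the function on the sphere vary with
`μ`, which is why holomorphic dependence is proved for families of functions on the sphere
(`IsHolomorphicFamilyAt`) rather than for a fixed one.
-/

namespace HomogeneousFourier
open Set Filter Topology

/-! ### Polar coordinates -/

/-- The surface measure on the unit sphere of `ℝ^N`. -/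
noncomputable abbrev surf (n : ℕ) : Measure (S n) := (volume : Measure (E n)).toSphere

/-- The measure on `S × ℝ` which corresponds to Lebesgue measure in polar coordinates, stripped of
its density `r ^ (N - 1)`. -/
noncomputable abbrev polarMeasure (n : ℕ) : Measure (S n × ℝ) :=
  (surf n).prod (volume.restrict (Ioi (0 : ℝ)))

lemma map_volumeIoiPow (n : ℕ) :
    (Measure.volumeIoiPow n).map (Subtype.val : Ioi (0 : ℝ) → ℝ) =
      (volume.restrict (Ioi (0 : ℝ))).withDensity (fun r => ENNReal.ofReal (r ^ n)) := by
  ext s hs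
  rw [Measure.map_apply measurable_subtype_coe hs, Measure.volumeIoiPow,
    withDensity_apply _ (measurable_subtype_coe hs), withDensity_apply _ hs,
    setLIntegral_subtype measurableSet_Ioi _ (fun a : ℝ => ENNReal.ofReal (a ^ n)),
    Subtype.image_preimage_coe, Measure.restrict_restrict hs, inter_comm]

lemma map_polar (n : ℕ) :
    ((surf n).prod (Measure.volumeIoiPow n)).map (Prod.map id (Subtype.val : Ioi (0 : ℝ) → ℝ)) =
      (polarMeasure n).withDensity (fun p => ENNReal.ofReal (p.2 ^ n)) := by
  rw [← Measure.map_prod_map _ _ measurable_id measurable_subtype_coe, Measure.map_id,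
    map_volumeIoiPow, prod_withDensity_right (by fun_prop)]

lemma measurableEmbedding_polar (n : ℕ) :
    MeasurableEmbedding (Prod.map id (Subtype.val : Ioi (0 : ℝ) → ℝ) : S n × Ioi (0 : ℝ) → _) :=
  MeasurableEmbedding.id.prodMap (MeasurableEmbedding.subtype_coe measurableSet_Ioi)

lemma measurePreserving_polar (n : ℕ) :
    MeasurePreserving (homeomorphUnitSphereProd (E n)) ((volume : Measure (E n)).comap (↑))
      ((surf n).prod (Measure.volumeIoiPow n)) := by
  simpa using (volume : Measure (E n)).measurePreserving_homeomorphUnitSphereProd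

/-- Integration in polar coordinates, as an equivalence of integrability. -/
lemma integrable_polar {n : ℕ} {F : Type*} [NormedAddCommGroup F] [NormedSpace ℝ F]
    (f : E n → F) :
    Integrable f ↔ Integrable (fun p : S n × ℝ => p.2 ^ n • f (p.2 • (p.1 : E n)))
      (polarMeasure n) := by
  have h1 := (measurePreserving_polar n).integrable_comp_emb
    (g := fun p => f ((p.2 : ℝ) • (p.1 : E n))) (Homeomorph.measurableEmbedding _)
  have h2 := (measurableEmbedding_polar n).integrable_map_iff
    (μ := (surf n).prod (Measure.volumeIoiPow n))
    (g := fun p : S n × ℝ => f (p.2 • (p.1 : E n)))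
  rw [map_polar, integrable_withDensity_iff_integrable_smul' (by fun_prop) (by simp)] at h2
  have h3 : Integrable f ↔ Integrable (fun x : ({0}ᶜ : Set (E n)) => f x)
      ((volume : Measure (E n)).comap (↑)) := by
    rw [← restrict_compl_singleton (μ := (volume : Measure (E n))) 0, ← IntegrableOn,
      integrableOn_iff_comap_subtypeVal (measurableSet_singleton _).compl]
    simp [Function.comp_def]
  have h4 : ∀ᵐ p ∂(polarMeasure n), (ENNReal.ofReal (p.2 ^ n)).toReal • f (p.2 • (p.1 : E n)) =
      p.2 ^ n • f (p.2 • (p.1 : E n)) := by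
    have h5 : ∀ᵐ p ∂(polarMeasure n), p.2 ∈ Ioi (0 : ℝ) :=
      Measure.quasiMeasurePreserving_snd.ae (ae_restrict_mem measurableSet_Ioi)
    filter_upwards [h5] with p hp
    rw [ENNReal.toReal_ofReal (pow_nonneg (le_of_lt hp) _)]
  rw [h3, ← integrable_congr h4, h2]
  refine Iff.trans ?_ h1
  refine iff_of_eq (congrArg₂ _ (funext fun x => ?_) rfl)
  have hx : ‖(x : E n)‖ ≠ 0 := norm_ne_zero_iff.2 x.2
  simp [homeomorphUnitSphereProd_apply_snd_coe, homeomorphUnitSphereProd_apply_fst_coe,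
    smul_smul, hx]

/-- Integration in polar coordinates, for functions which need not be integrable. -/
lemma integral_polarMeasure {n : ℕ} {F : Type*} [NormedAddCommGroup F] [NormedSpace ℝ F]
    (f : E n → F) :
    ∫ x, f x = ∫ p : S n × ℝ, p.2 ^ n • f (p.2 • (p.1 : E n)) ∂(polarMeasure n) := by
  have h1 := (measurePreserving_polar n).integral_comp (Homeomorph.measurableEmbedding _)
    (fun p => f ((p.2 : ℝ) • (p.1 : E n)))
  have h2 := (measurableEmbedding_polar n).integral_map
    (μ := (surf n).prod (Measure.volumeIoiPow n))
    (fun p : S n × ℝ => f (p.2 • (p.1 : E n)))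
  rw [map_polar, integral_withDensity_eq_integral_toReal_smul (by fun_prop) (by simp)] at h2
  have h3 : ∫ x, f x = ∫ x : ({0}ᶜ : Set (E n)), f x ∂((volume : Measure (E n)).comap (↑)) := by
    rw [integral_subtype_comap (measurableSet_singleton _).compl f, restrict_compl_singleton]
  have h4 : ∀ᵐ p ∂(polarMeasure n), (ENNReal.ofReal (p.2 ^ n)).toReal • f (p.2 • (p.1 : E n)) =
      p.2 ^ n • f (p.2 • (p.1 : E n)) := by
    have h5 : ∀ᵐ p ∂(polarMeasure n), p.2 ∈ Ioi (0 : ℝ) :=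
      Measure.quasiMeasurePreserving_snd.ae (ae_restrict_mem measurableSet_Ioi)
    filter_upwards [h5] with p hp
    rw [ENNReal.toReal_ofReal (pow_nonneg (le_of_lt hp) _)]
  rw [h3, ← integral_congr_ae h4, h2]
  refine Eq.trans (integral_congr_ae (.of_forall fun x => ?_)) h1
  have hx : ‖(x : E n)‖ ≠ 0 := norm_ne_zero_iff.2 x.2
  simp [homeomorphUnitSphereProd_apply_snd_coe, homeomorphUnitSphereProd_apply_fst_coe,
    smul_smul, hx]

/-- Integration in polar coordinates. -/
lemma integral_polar {n : ℕ} {F : Type*} [NormedAddCommGroup F] [NormedSpace ℝ F]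
    {f : E n → F} (hf : Integrable f) :
    ∫ x, f x = ∫ σ : S n, (∫ r in Ioi (0 : ℝ), r ^ n • f (r • (σ : E n))) ∂(surf n) := by
  rw [integral_polarMeasure, integral_prod _ ((integrable_polar f).1 hf)]

/-! ### Integrability -/

lemma integrableOn_rpow_mul_weight {s : ℝ} {k : ℕ} (hs : 0 < s) (hk : s < k) :
    IntegrableOn (fun r : ℝ => r ^ (s - 1) * ((1 + r) ^ k)⁻¹) (Ioi 0) := by
  have hm : Measurable (fun r : ℝ => r ^ (s - 1) * ((1 + r) ^ k)⁻¹) := by fun_prop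
  rw [← Ioc_union_Ioi_eq_Ioi zero_le_one]
  refine IntegrableOn.union ?_ ?_
  · have h1 : IntegrableOn (fun r : ℝ => r ^ (s - 1)) (Ioc 0 1) := by
      have := intervalIntegral.intervalIntegrable_rpow' (a := 0) (b := 1) (r := s - 1) (by linarith)
      rwa [intervalIntegrable_iff_integrableOn_Ioc_of_le zero_le_one] at this
    refine Integrable.mono' h1 hm.aestronglyMeasurable ?_
    refine (ae_restrict_iff' measurableSet_Ioc).2 (.of_forall fun r hr => ?_)
    have h0 : 0 ≤ r ^ (s - 1) := Real.rpow_nonneg hr.1.le _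
    have h2 : ((1 + r) ^ k)⁻¹ ≤ 1 := inv_le_one_of_one_le₀ (one_le_pow₀ (by linarith [hr.1]))
    have h3 : 0 ≤ ((1 + r) ^ k)⁻¹ := inv_nonneg.2 (pow_nonneg (by linarith [hr.1]) _)
    rw [Real.norm_of_nonneg (mul_nonneg h0 h3)]
    exact mul_le_of_le_one_right h0 h2
  · have h1 : IntegrableOn (fun r : ℝ => r ^ (s - 1 - k)) (Ioi 1) :=
      integrableOn_Ioi_rpow_of_lt (by linarith) zero_lt_one
    refine Integrable.mono' h1 hm.aestronglyMeasurable ?_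
    refine (ae_restrict_iff' measurableSet_Ioi).2 (.of_forall fun r hr => ?_)
    have hr0 : (0 : ℝ) < r := lt_trans zero_lt_one hr
    have h0 : 0 ≤ r ^ (s - 1) := Real.rpow_nonneg hr0.le _
    rw [Real.norm_of_nonneg (by positivity), Real.rpow_sub hr0 (s - 1) k, Real.rpow_natCast,
      div_eq_mul_inv]
    gcongr
    linarith

lemma integrable_norm_rpow_mul_weight {n k : ℕ} {σ : ℝ} (hσ : -((n + 1 : ℕ) : ℝ) < σ)
    (hk : σ + (n + 1 : ℕ) < k) :
    Integrable (fun x : E n => ‖x‖ ^ σ * ((1 + ‖x‖) ^ k)⁻¹) := by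
  rw [integrable_fun_norm_addHaar volume (f := fun r : ℝ => r ^ σ * ((1 + r) ^ k)⁻¹)]
  have h := integrableOn_rpow_mul_weight (s := σ + (n + 1 : ℕ)) (k := k) (by linarith) hk
  refine h.congr_fun (fun r hr => ?_) measurableSet_Ioi
  have : Module.finrank ℝ (E n) - 1 = n := by simp
  simp only [this, smul_eq_mul]
  rw [← mul_assoc, ← Real.rpow_natCast r n, ← Real.rpow_add hr]
  congr 2
  push_cast
  ring

/-- The isometry which exchanges two points of the sphere. -/
lemma exists_isometry {n : ℕ} (η ξ : S n) : ∃ L : E n ≃ₗᵢ[ℝ] E n, L η = ξ :=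
  ⟨(ℝ ∙ ((η : E n) - ξ))ᗮ.reflection, Submodule.reflection_sub (by simp)⟩

lemma integrable_abs_rpow_mul {σ : ℝ} (h0 : 0 ≤ σ) (h1 : σ < 1) :
    Integrable (fun t : ℝ => |t| ^ (-σ) * (1 + t ^ 2)⁻¹) := by
  have h : IntegrableOn (fun t : ℝ => t ^ (-σ) * (1 + t ^ 2)⁻¹) (Ioi 0) := by
    have h2 := (integrableOn_rpow_mul_weight (s := 1 - σ) (k := 2) (by linarith)
      (by push_cast; linarith)).const_mul 2
    refine Integrable.mono' h2 (by fun_prop) ?_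
    refine (ae_restrict_iff' measurableSet_Ioi).2 (.of_forall fun r (hr : 0 < r) => ?_)
    have h3 : (0 : ℝ) ≤ r ^ (-σ) := Real.rpow_nonneg hr.le _
    rw [Real.norm_of_nonneg (by positivity), show 1 - σ - 1 = -σ by ring, ← mul_assoc, mul_comm 2,
      mul_assoc]
    gcongr
    rw [← div_eq_mul_inv, inv_eq_one_div, div_le_div_iff₀ (by positivity) (by positivity)]
    nlinarith [sq_nonneg (r - 1)]
  have h2 := (integrable_fun_norm_addHaar (E := ℝ) volume
    (f := fun t : ℝ => t ^ (-σ) * (1 + t ^ 2)⁻¹)).2 (by simpa using h)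
  simpa using h2

lemma integrable_inner_rpow_aux {n : ℕ} {σ : ℝ} (h0 : 0 ≤ σ) (h1 : σ < 1) :
    Integrable (fun x : E n => |x 0| ^ (-σ) * ((1 + ‖x‖) ^ (2 * (n + 1)))⁻¹) := by
  have h : Integrable (fun v : Fin (n + 1) → ℝ =>
      ∏ i, (if i = 0 then |v i| ^ (-σ) * (1 + v i ^ 2)⁻¹ else (1 + v i ^ 2)⁻¹)) := by
    refine Integrable.fintype_prod (f := fun (i : Fin (n + 1)) (t : ℝ) =>
      (if i = 0 then |t| ^ (-σ) * (1 + t ^ 2)⁻¹ else (1 + t ^ 2)⁻¹)) fun i => ?_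
    by_cases hi : i = 0
    · simpa [hi] using integrable_abs_rpow_mul h0 h1
    · simpa [hi] using integrable_inv_one_add_sq
  rw [← (PiLp.volume_preserving_toLp (Fin (n + 1))).integrable_comp_emb
    (MeasurableEquiv.toLp 2 _).measurableEmbedding]
  refine h.mono' (Measurable.aestronglyMeasurable ?_) (.of_forall fun v => ?_)
  · simp only [Function.comp_def]
    fun_prop
  · simp only [Function.comp_def]
    have h2 : (0 : ℝ) ≤ |v 0| ^ (-σ) := Real.rpow_nonneg (abs_nonneg _) _
    rw [Real.norm_of_nonneg (by positivity), Fin.prod_univ_succ]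
    simp only [if_true, Fin.succ_ne_zero, if_false, mul_assoc]
    refine mul_le_mul_of_nonneg_left ?_ h2
    rw [← Fin.prod_univ_succ (fun i => (1 + v i ^ 2)⁻¹), Finset.prod_inv_distrib]
    refine inv_anti₀ (Finset.prod_pos fun i _ => by positivity) ?_
    rw [pow_mul]
    calc ∏ i, (1 + v i ^ 2) ≤ ∏ _i : Fin (n + 1), (1 + ‖WithLp.toLp 2 v‖) ^ 2 := by
          refine Finset.prod_le_prod (fun i _ => by positivity) fun i _ => ?_
          have h3 : |v i| ≤ ‖WithLp.toLp 2 v‖ := PiLp.norm_apply_le (WithLp.toLp 2 v) i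
          have h4 := sq_le_sq' (by linarith [abs_nonneg (v i), norm_nonneg (WithLp.toLp 2 v)]) h3
          rw [sq_abs] at h4
          nlinarith [norm_nonneg (WithLp.toLp 2 v)]
      _ = _ := by simp

/-- The majorant used for the kernel `|⟨x, η⟩| ^ (-σ)`. Its integral does not depend on `η`, because
the majorant for `η` is that for a coordinate vector composed with an isometry. -/
lemma integrable_inner_rpow {n : ℕ} {σ : ℝ} (h0 : 0 ≤ σ) (h1 : σ < 1) (η : S n) :
    Integrable (fun x : E n => |inner ℝ x (η : E n)| ^ (-σ) *
      ((1 + ‖x‖) ^ (2 * (n + 1)))⁻¹) ∧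
    ∫ x : E n, |inner ℝ x (η : E n)| ^ (-σ) * ((1 + ‖x‖) ^ (2 * (n + 1)))⁻¹ =
    ∫ x : E n, |x 0| ^ (-σ) * ((1 + ‖x‖) ^ (2 * (n + 1)))⁻¹ := by
  obtain ⟨L, hL⟩ := exists_isometry η ⟨EuclideanSpace.single 0 1, by simp⟩
  have hc : (fun x : E n => |inner ℝ x (η : E n)| ^ (-σ) * ((1 + ‖x‖) ^ (2 * (n + 1)))⁻¹) =
      (fun x : E n => |x 0| ^ (-σ) * ((1 + ‖x‖) ^ (2 * (n + 1)))⁻¹) ∘ L := by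
    funext x
    have : inner ℝ x (η : E n) = (L x) 0 := by
      rw [← L.inner_map_map, hL]
      simp [EuclideanSpace.inner_single_right]
    simp [this]
  have hemb : MeasurableEmbedding L := L.toHomeomorph.measurableEmbedding
  constructor
  · rw [hc, L.measurePreserving.integrable_comp_emb hemb]
    exact integrable_inner_rpow_aux h0 h1
  · rw [hc]
    exact L.measurePreserving.integral_comp hemb
      (fun x : E n => |x 0| ^ (-σ) * ((1 + ‖x‖) ^ (2 * (n + 1)))⁻¹)

/-! ### Dominated integrals -/

/-- A dominated integral of holomorphic functions is holomorphic. By Cauchy's estimate it suffices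
to dominate the functions, rather than their derivatives. -/
lemma differentiableOn_integral_of_dominated {α : Type*} [MeasurableSpace α] {ν : Measure α}
    {U : Set ℂ} (hU : IsOpen U) {F : ℂ → α → ℂ} {g : α → ℝ}
    (hm : ∀ z ∈ U, AEStronglyMeasurable (F z) ν)
    (hd : ∀ᵐ x ∂ν, DifferentiableOn ℂ (fun z => F z x) U) (hg : Integrable g ν)
    (hb : ∀ᵐ x ∂ν, ∀ z ∈ U, ‖F z x‖ ≤ g x) :
    DifferentiableOn ℂ (fun z => ∫ x, F z x ∂ν) U := by
  intro z₀ hz₀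
  obtain ⟨ε, hε, hεU⟩ := Metric.isOpen_iff.1 hU z₀ hz₀
  have hε2 : 0 < ε / 2 := half_pos hε
  have hder : ∀ᵐ x ∂ν, ∀ z ∈ U, HasDerivAt (fun w => F w x) (deriv (fun w => F w x) z) z := by
    filter_upwards [hd] with x hx z hz
    exact (hx.differentiableAt (hU.mem_nhds hz)).hasDerivAt
  have hm' : AEStronglyMeasurable (fun x => deriv (fun w => F w x) z₀) ν := by
    let u : ℕ → ℂ := fun k => ((ε / 2 / (k + 1) : ℝ) : ℂ)
    have hu0 : ∀ k, u k ≠ 0 := fun k => Complex.ofReal_ne_zero.2 (by positivity)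
    have hut : Filter.Tendsto u Filter.atTop (nhdsWithin 0 {0}ᶜ) := by
      refine tendsto_nhdsWithin_iff.2 ⟨?_, .of_forall hu0⟩
      have h1 : Filter.Tendsto (fun k : ℕ => ε / 2 * (1 / ((k : ℝ) + 1))) Filter.atTop
          (nhds (ε / 2 * 0)) := tendsto_one_div_add_atTop_nhds_zero_nat.const_mul _
      have h2 := (Complex.continuous_ofReal.tendsto _).comp h1
      simpa [u, Function.comp_def, div_eq_mul_inv] using h2
    refine aestronglyMeasurable_of_tendsto_ae Filter.atTop
      (f := fun k x => (u k)⁻¹ • (F (z₀ + u k) x - F z₀ x)) (fun k => ?_) ?_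
    · have hk : z₀ + u k ∈ U := hεU ?_
      · exact ((hm _ hk).sub (hm _ hz₀)).const_smul ((u k)⁻¹ : ℂ)
      have : ε / 2 / ((k : ℝ) + 1) ≤ ε / 2 := div_le_self hε2.le (by linarith [k.cast_nonneg (α := ℝ)])
      simp only [mem_ball, dist_self_add_left, u, Complex.norm_real]
      rw [Real.norm_of_nonneg (by positivity)]
      linarith
    · filter_upwards [hder] with x hx
      exact (hasDerivAt_iff_tendsto_slope_zero.1 (hx z₀ hz₀)).comp hut
  refine (hasDerivAt_integral_of_dominated_loc_of_deriv_le (Metric.ball_mem_nhds z₀ hε2)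
    (F' := fun z x => deriv (fun w => F w x) z) (bound := fun x => g x / (ε / 2))
    ?_ ?_ hm' ?_ (hg.div_const _) ?_).2.differentiableAt.differentiableWithinAt
  · exact Filter.eventually_of_mem (hU.mem_nhds hz₀) hm
  · refine hg.mono' (hm _ hz₀) ?_
    filter_upwards [hb] with x hx using hx _ hz₀
  · filter_upwards [hd, hb] with x hx hbx z hz
    have hsub : closedBall z (ε / 2) ⊆ U := fun w hw => hεU <| by
      have := dist_triangle w z z₀
      rw [mem_closedBall] at hw
      rw [mem_ball] at hz ⊢
      linarith
    refine Complex.norm_deriv_le_of_forall_mem_sphere_norm_le hε2 ?_ fun w hw =>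
      hbx w (hsub (sphere_subset_closedBall hw))
    exact (hx.mono hsub).diffContOnCl_ball subset_rfl
  · filter_upwards [hder] with x hx z hz
    refine hx z (hεU ?_)
    rw [mem_ball] at hz ⊢
    linarith

/-- The kernel `|⟨σ, η⟩| ^ (-s)` is integrable over the sphere for `s < 1`, and its integral does
not depend on `η`. -/
lemma exists_integral_sphere_kernel (n : ℕ) {s : ℝ} (h0 : 0 ≤ s) (h1 : s < 1) :
    ∃ K : ℝ, ∀ η : S n,
      Integrable (fun σ : S n => |inner ℝ (σ : E n) (η : E n)| ^ (-s)) (surf n) ∧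
      ∫ σ : S n, |inner ℝ (σ : E n) (η : E n)| ^ (-s) ∂(surf n) = K := by
  set J : ℝ := ∫ x : E n, |x 0| ^ (-s) * ((1 + ‖x‖) ^ (2 * (n + 1)))⁻¹
  set w : ℝ → ℝ := fun r => r ^ n * r ^ (-s) * ((1 + r) ^ (2 * (n + 1)))⁻¹
  set c : ℝ := ∫ r in Ioi (0 : ℝ), w r
  have hw : IntegrableOn w (Ioi 0) := by
    have := integrableOn_rpow_mul_weight (s := n + 1 - s) (k := 2 * (n + 1))
      (by linarith [n.cast_nonneg (α := ℝ)]) (by push_cast; linarith [n.cast_nonneg (α := ℝ)])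
    refine this.congr_fun (fun r hr => ?_) measurableSet_Ioi
    simp only [w]
    rw [← Real.rpow_natCast r n, ← Real.rpow_add hr]
    congr 2
    ring
  have hwpos : ∀ r ∈ Ioi (0 : ℝ), 0 < w r := fun r (hr : 0 < r) => by
    have := Real.rpow_pos_of_pos hr (-s)
    positivity
  have hc : 0 < c := by
    refine (setIntegral_pos_iff_support_of_nonneg_ae ?_ hw).2 ?_
    · exact (ae_restrict_iff' measurableSet_Ioi).2 (.of_forall fun r hr => (hwpos r hr).le)
    · have hsub : Ioi (0 : ℝ) ⊆ Function.support w := fun r hr => (hwpos r hr).ne'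
      rw [inter_eq_self_of_subset_right hsub]
      simp
  refine ⟨J / c, fun η => ?_⟩
  obtain ⟨hi, hJ⟩ := integrable_inner_rpow h0 h1 η
  have he : ∀ᵐ p ∂(polarMeasure n), p.2 ^ n • (|inner ℝ (p.2 • (p.1 : E n)) (η : E n)| ^ (-s) *
      ((1 + ‖p.2 • (p.1 : E n)‖) ^ (2 * (n + 1)))⁻¹) =
      |inner ℝ (p.1 : E n) (η : E n)| ^ (-s) * w p.2 := by
    have h5 : ∀ᵐ p ∂(polarMeasure n), p.2 ∈ Ioi (0 : ℝ) :=
      Measure.quasiMeasurePreserving_snd.ae (ae_restrict_mem measurableSet_Ioi)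
    filter_upwards [h5] with p (hp : 0 < p.2)
    simp only [w, real_inner_smul_left, abs_mul, norm_smul, Real.norm_eq_abs, abs_of_pos hp,
      norm_eq_of_mem_sphere, mul_one, smul_eq_mul]
    rw [Real.mul_rpow hp.le (abs_nonneg _)]
    ring
  rw [integrable_polar, integrable_congr he] at hi
  rw [integral_polarMeasure, integral_congr_ae he,
    integral_prod_mul (fun σ : S n => |inner ℝ (σ : E n) (η : E n)| ^ (-s)) w] at hJ
  refine ⟨?_, by rw [eq_div_iff hc.ne']; exact hJ⟩
  have : NeZero ((volume : Measure ℝ).restrict (Ioi 0)) := ⟨by simp⟩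
  obtain ⟨r, hr, hr0⟩ := (hi.prod_left_ae.and (ae_restrict_mem measurableSet_Ioi)).exists
  have := hr.mul_const (w r)⁻¹
  simpa [mul_assoc, (hwpos r hr0).ne'] using this

/-- For `t = 0` this uses the values `0 ^ z = 0` (`z ≠ 0`) and `0 ^ 0 = 1`. -/
lemma norm_cpow_le {t : ℝ} (h0 : 0 ≤ t) (h1 : t ≤ 1) {z : ℂ} {s : ℝ} (hs : -s ≤ z.re) :
    ‖(t : ℂ) ^ z‖ ≤ 1 + t ^ (-s) := by
  rcases h0.eq_or_lt with rfl | h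
  · have h2 : ‖((0 : ℝ) : ℂ) ^ z‖ ≤ 1 := by
      by_cases hz : z = 0 <;> simp [hz]
    linarith [Real.rpow_nonneg le_rfl (-s) (x := 0)]
  · rw [Complex.norm_cpow_eq_rpow_re_of_pos h]
    linarith [Real.rpow_le_rpow_of_exponent_ge h h1 hs]

lemma cpow_eq_exp {y : ℝ} (hy : 0 < y) (z : ℂ) :
    (y : ℂ) ^ z = Complex.exp ((Real.log y : ℂ) * z) := by
  rw [Complex.cpow_def_of_ne_zero (Complex.ofReal_ne_zero.2 hy.ne'), Complex.ofReal_log hy.le]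

/-! ### The Fourier transform in one direction -/

lemma integrableOn_rpow_mul_exp {s b : ℝ} (hs : 0 < s) (hb : 0 < b) :
    IntegrableOn (fun u : ℝ => u ^ (s - 1) * Real.exp (-(b * u))) (Ioi 0) := by
  refine Integrable.of_integral_ne_zero ?_
  rw [Real.integral_rpow_mul_exp_neg_mul_Ioi hs hb]
  have := Real.Gamma_pos_of_pos hs
  positivity

/-- The Mellin transform of a superposition of Gaussians. It is used with `t x = ⟨x, η⟩` on `ℝ^N`
and with `t r = r` on the line. -/
lemma mellin_gaussian {X : Type*} [MeasurableSpace X] {ν : Measure X} [SFinite ν] {t : X → ℝ}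
    (ht : Measurable t) (ht0 : ∀ᵐ x ∂ν, t x ≠ 0) {F : X → ℂ} (hF : AEStronglyMeasurable F ν) {s : ℂ}
    (hs : 0 < s.re) (hi : Integrable (fun x => |t x| ^ (-(2 * s.re)) * ‖F x‖) ν) :
    mellin (fun u => ∫ x, ((Real.exp (-(Real.pi * u * t x ^ 2)) : ℝ) : ℂ) * F x ∂ν) s =
      (Real.pi : ℂ) ^ (-s) * Complex.Gamma s *
        ∫ x, ((|t x| : ℝ) : ℂ) ^ (-(2 * s)) * F x ∂ν := by
  have hpos : ∀ y : ℝ, y ≠ 0 → 0 < Real.pi * y ^ 2 := fun y hy => by positivity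
  have hm : AEStronglyMeasurable (fun p : X × ℝ => (p.2 : ℂ) ^ (s - 1) *
      (((Real.exp (-(Real.pi * p.2 * t p.1 ^ 2)) : ℝ) : ℂ) * F p.1))
      (ν.prod (volume.restrict (Ioi 0))) := by
    refine AEStronglyMeasurable.mul (Measurable.aestronglyMeasurable (by fun_prop)) ?_
    exact AEStronglyMeasurable.mul (Measurable.aestronglyMeasurable (by fun_prop)) hF.comp_fst
  have hnorm : ∀ x, ∀ u ∈ Ioi (0 : ℝ), ‖(u : ℂ) ^ (s - 1) *
      (((Real.exp (-(Real.pi * u * t x ^ 2)) : ℝ) : ℂ) * F x)‖ =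
      (u ^ (s.re - 1) * Real.exp (-(Real.pi * t x ^ 2 * u))) * ‖F x‖ := fun x u hu => by
    rw [norm_mul, norm_mul, Complex.norm_cpow_eq_rpow_re_of_pos hu, Complex.norm_real,
      Real.norm_of_nonneg (Real.exp_pos _).le, Complex.sub_re, Complex.one_re, ← mul_assoc,
      mul_right_comm Real.pi]
  have hint : Integrable (fun p : X × ℝ => (p.2 : ℂ) ^ (s - 1) *
      (((Real.exp (-(Real.pi * p.2 * t p.1 ^ 2)) : ℝ) : ℂ) * F p.1))
      (ν.prod (volume.restrict (Ioi 0))) := by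
    rw [integrable_prod_iff hm]
    constructor
    · filter_upwards [ht0, hm.prodMk_left] with x hx hmx
      refine ((integrableOn_rpow_mul_exp hs (hpos _ hx)).mul_const ‖F x‖).mono' hmx ?_
      exact (ae_restrict_iff' measurableSet_Ioi).2 (.of_forall fun u hu => (hnorm x u hu).le)
    · refine (hi.const_mul (Real.pi ^ (-s.re) * Real.Gamma s.re)).congr ?_
      filter_upwards [ht0] with x hx
      rw [setIntegral_congr_fun measurableSet_Ioi (hnorm x), integral_mul_const,
        Real.integral_rpow_mul_exp_neg_mul_Ioi hs (hpos _ hx), one_div,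
        Real.inv_rpow (hpos _ hx).le, ← Real.rpow_neg (hpos _ hx).le,
        Real.mul_rpow Real.pi_pos.le (sq_nonneg _), ← sq_abs (t x), ← Real.rpow_natCast (|t x|),
        ← Real.rpow_mul (abs_nonneg _)]
      push_cast
      rw [show (2 : ℝ) * -s.re = -(2 * s.re) by ring]
      ring
  have h1 : mellin (fun u => ∫ x, ((Real.exp (-(Real.pi * u * t x ^ 2)) : ℝ) : ℂ) * F x ∂ν) s =
      ∫ u in Ioi (0 : ℝ), ∫ x, (u : ℂ) ^ (s - 1) *
        (((Real.exp (-(Real.pi * u * t x ^ 2)) : ℝ) : ℂ) * F x) ∂ν := by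
    simp only [mellin, integral_const_mul, smul_eq_mul]
  rw [h1, ← integral_integral_swap (f := fun x (u : ℝ) => (u : ℂ) ^ (s - 1) *
        (((Real.exp (-(Real.pi * u * t x ^ 2)) : ℝ) : ℂ) * F x)) hint, ← integral_const_mul]
  refine integral_congr_ae ?_
  filter_upwards [ht0] with x hx
  have h2 := Complex.integral_cpow_mul_exp_neg_mul_Ioi hs (hpos _ hx)
  have h3 : ∫ u in Ioi (0 : ℝ), (u : ℂ) ^ (s - 1) *
        (((Real.exp (-(Real.pi * u * t x ^ 2)) : ℝ) : ℂ) * F x) =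
      ((1 / ((Real.pi * t x ^ 2 : ℝ) : ℂ)) ^ s * Complex.Gamma s) * F x := by
    rw [← h2, ← integral_mul_const]
    congr 1
    funext u
    push_cast
    rw [mul_right_comm (Real.pi : ℂ)]
    ring
  rw [h3]
  have h4 : (1 / ((Real.pi * t x ^ 2 : ℝ) : ℂ)) ^ s =
      (Real.pi : ℂ) ^ (-s) * ((|t x| : ℝ) : ℂ) ^ (-(2 * s)) := by
    have hx' : 0 < |t x| := abs_pos.2 hx
    rw [one_div, ← Complex.ofReal_inv, cpow_eq_exp (inv_pos.2 (hpos _ hx)),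
      cpow_eq_exp Real.pi_pos, cpow_eq_exp hx', ← Complex.exp_add, ← sq_abs (t x), Real.log_inv,
      Real.log_mul Real.pi_ne_zero (by positivity), Real.log_pow]
    push_cast
    congr 1
    ring
  rw [h4]
  ring

/-- The Fourier transform carries a Gaussian in the single variable `⟨x, η⟩` to a Gaussian on the
line spanned by `η`. -/
lemma integral_gaussian_inner {n : ℕ} (H : 𝓢(E n, ℂ)) (η : S n) {u : ℝ} (hu : 0 < u) :
    ∫ x : E n, ((Real.exp (-(Real.pi * u * inner ℝ x (η : E n) ^ 2)) : ℝ) : ℂ) * H x =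
      (u : ℂ) ^ (-(1 / 2) : ℂ) *
      ∫ r : ℝ, ((Real.exp (-(Real.pi * u⁻¹ * r ^ 2)) : ℝ) : ℂ) * 𝓕 H (r • (η : E n)) := by
  have hu' : 0 < ((u⁻¹ : ℝ) : ℂ).re := by simpa using hu
  have hg : Integrable (fun r : ℝ => ((Real.exp (-(Real.pi * u⁻¹ * r ^ 2)) : ℝ) : ℂ)) := by
    have := (integrable_exp_neg_mul_sq (b := Real.pi * u⁻¹) (by positivity)).ofReal (𝕜 := ℂ)
    refine this.congr (.of_forall fun r => ?_)
    simp [neg_mul]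
  have hfour : ∀ t : ℝ, 𝓕 (fun r : ℝ => ((Real.exp (-(Real.pi * u⁻¹ * r ^ 2)) : ℝ) : ℂ)) t =
      (u : ℂ) ^ (1 / 2 : ℂ) * ((Real.exp (-(Real.pi * u * t ^ 2)) : ℝ) : ℂ) := by
    intro t
    have h := congrFun (fourier_gaussian_pi hu') t
    have h1 : (fun x : ℝ => Complex.exp (-Real.pi * ((u⁻¹ : ℝ) : ℂ) * (x : ℂ) ^ 2)) =
        fun r : ℝ => ((Real.exp (-(Real.pi * u⁻¹ * r ^ 2)) : ℝ) : ℂ) := by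
      funext r
      push_cast
      congr 1
      ring
    rw [h1] at h
    rw [h, cpow_eq_exp (inv_pos.2 hu), cpow_eq_exp hu, one_div, ← Complex.exp_neg, Real.log_inv]
    push_cast
    congr 2
    · ring
    · field_simp
  let L : E n →ₗ[ℝ] ℝ →ₗ[ℝ] ℝ := LinearMap.mk₂ ℝ (fun x r => r * inner ℝ x (η : E n))
    (by intros; simp [inner_add_left]; ring) (by intros; simp [real_inner_smul_left]; ring)
    (by intros; ring) (by intros; simp [mul_assoc])
  have hflip := VectorFourier.integral_fourierIntegral_smul_eq_flip (μ := (volume : Measure (E n)))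
    (ν := (volume : Measure ℝ)) (L := L) Real.continuous_fourierChar
    (by simp only [L, LinearMap.mk₂_apply]; fun_prop) H.integrable hg
  have h1 : ∀ r : ℝ, VectorFourier.fourierIntegral Real.fourierChar volume L H r =
      𝓕 H (r • (η : E n)) := by
    intro r
    rw [SchwartzMap.fourier_coe, Real.fourier_eq]
    simp [VectorFourier.fourierIntegral, L, real_inner_smul_right]
  have h2 : ∀ x : E n, VectorFourier.fourierIntegral Real.fourierChar volume L.flip
      (fun r : ℝ => ((Real.exp (-(Real.pi * u⁻¹ * r ^ 2)) : ℝ) : ℂ)) x =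
      (u : ℂ) ^ (1 / 2 : ℂ) *
        ((Real.exp (-(Real.pi * u * inner ℝ x (η : E n) ^ 2)) : ℝ) : ℂ) := by
    intro x
    rw [← hfour, Real.fourier_eq]
    simp [VectorFourier.fourierIntegral, L, mul_comm]
  simp only [h1, h2, smul_eq_mul] at hflip
  have h3 : (u : ℂ) ^ (-(1 / 2) : ℂ) * (u : ℂ) ^ (1 / 2 : ℂ) = 1 := by
    rw [← Complex.cpow_add _ _ (Complex.ofReal_ne_zero.2 hu.ne')]
    simp
  calc _ = ∫ x : E n, (u : ℂ) ^ (-(1 / 2) : ℂ) * (H x * ((u : ℂ) ^ (1 / 2 : ℂ) *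
        ((Real.exp (-(Real.pi * u * inner ℝ x (η : E n) ^ 2)) : ℝ) : ℂ))) := by
        congr 1
        funext x
        linear_combination -(H x * ((Real.exp (-(Real.pi * u * inner ℝ x (η : E n) ^ 2)) : ℝ) : ℂ))
          * h3
    _ = _ := by
        rw [integral_const_mul, ← hflip]
        congr 2
        funext r
        ring

lemma exists_weight_bound {n : ℕ} {F : Type*} [NormedAddCommGroup F] [NormedSpace ℝ F]
    (ψ : 𝓢(E n, F)) (k : ℕ) : ∃ K : ℝ, 0 ≤ K ∧ ∀ x, ‖ψ x‖ ≤ K * ((1 + ‖x‖) ^ k)⁻¹ := by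
  refine ⟨2 ^ k * (Finset.Iic (k, 0)).sup (fun m => SchwartzMap.seminorm ℝ m.1 m.2) ψ,
    by positivity, fun x => ?_⟩
  have h := SchwartzMap.one_add_le_sup_seminorm_apply (𝕜 := ℝ) (m := (k, 0)) (k := k) (n := 0)
    le_rfl le_rfl ψ x
  rw [norm_iteratedFDeriv_zero] at h
  rw [← div_eq_mul_inv, le_div_iff₀ (by positivity), mul_comm]
  exact h

lemma integrable_abs_rpow_ray {n : ℕ} {F : Type*} [NormedAddCommGroup F] [NormedSpace ℝ F]
    (ψ : 𝓢(E n, F)) (η : S n) {s : ℝ} (hs : 0 < s) :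
    Integrable (fun r : ℝ => |r| ^ (s - 1) * ‖ψ (r • (η : E n))‖) := by
  obtain ⟨k, hk⟩ := exists_nat_gt s
  obtain ⟨K, hK, hb⟩ := exists_weight_bound ψ k
  have h1 : Integrable (fun r : ℝ => |r| ^ (s - 1) * ((1 + |r|) ^ k)⁻¹) := by
    have := (integrable_fun_norm_addHaar (E := ℝ) volume
      (f := fun t : ℝ => t ^ (s - 1) * ((1 + t) ^ k)⁻¹)).2
      (by simpa using integrableOn_rpow_mul_weight hs hk)
    simpa using this
  have hc : Continuous (fun r : ℝ => ‖ψ (r • (η : E n))‖) := by fun_prop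
  refine (h1.const_mul K).mono' (AEStronglyMeasurable.mul
    (Measurable.aestronglyMeasurable (by fun_prop)) hc.aestronglyMeasurable) (.of_forall fun r => ?_)
  rw [Real.norm_of_nonneg (mul_nonneg (Real.rpow_nonneg (abs_nonneg _) _) (norm_nonneg _)),
    mul_left_comm]
  refine mul_le_mul_of_nonneg_left ?_ (Real.rpow_nonneg (abs_nonneg _) _)
  simpa [norm_smul] using hb (r • (η : E n))

lemma ae_inner_ne_zero {n : ℕ} (η : S n) : ∀ᵐ x : E n, inner ℝ x (η : E n) ≠ 0 := by
  have h : (volume : Measure (E n)) ((ℝ ∙ (η : E n))ᗮ : Submodule ℝ (E n)) = 0 := by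
    refine Measure.addHaar_submodule _ _ fun h => ?_
    have h2 : (η : E n) ∈ (ℝ ∙ (η : E n))ᗮ := h ▸ Submodule.mem_top
    rw [Submodule.mem_orthogonal_singleton_iff_inner_left, inner_self_eq_zero] at h2
    exact ne_zero_of_mem_unit_sphere η h2
  refine measure_mono_null (fun x hx => ?_) h
  simpa [Submodule.mem_orthogonal_singleton_iff_inner_left] using hx

lemma integrable_inner_rpow_mul {n : ℕ} (H : 𝓢(E n, ℂ)) {s : ℝ} (h0 : 0 ≤ s) (h1 : s < 1)
    (η : S n) : Integrable (fun x : E n => |inner ℝ x (η : E n)| ^ (-s) * ‖H x‖) := by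
  obtain ⟨K, hK, hb⟩ := exists_weight_bound H (2 * (n + 1))
  refine ((integrable_inner_rpow h0 h1 η).1.const_mul K).mono' (AEStronglyMeasurable.mul
    (Measurable.aestronglyMeasurable (by fun_prop)) H.continuous.norm.aestronglyMeasurable)
    (.of_forall fun x => ?_)
  rw [Real.norm_of_nonneg (mul_nonneg (Real.rpow_nonneg (abs_nonneg _) _) (norm_nonneg _)),
    mul_left_comm]
  exact mul_le_mul_of_nonneg_left (hb x) (Real.rpow_nonneg (abs_nonneg _) _)

/-- The one-dimensional case of the theorem, along the line spanned by `η`: the Fourier transform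
of `|t| ^ (-a)` is a multiple of `|r| ^ (a - 1)`. Both sides are Mellin transforms of a
superposition of Gaussians, and the Fourier transform of a Gaussian is known. -/
lemma integral_kernel_eq_fourier {n : ℕ} (H : 𝓢(E n, ℂ)) (η : S n) {a : ℂ} (h0 : 0 < a.re)
    (h1 : a.re < 1) :
    ∫ x : E n, ((|inner ℝ x (η : E n)| : ℝ) : ℂ) ^ (-a) * H x =
      (Real.pi : ℂ) ^ (a - 1 / 2) * Complex.Gamma ((1 - a) / 2) / Complex.Gamma (a / 2) *
        ∫ r : ℝ, ((|r| : ℝ) : ℂ) ^ (a - 1) * 𝓕 H (r • (η : E n)) := by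
  have hs1 : 0 < (a / 2).re := by simpa using h0
  have hs2 : 0 < ((1 - a) / 2).re := by simpa using h1
  have hr2 : (a / 2).re = a.re / 2 := by simp
  have hr3 : ((1 - a) / 2).re = (1 - a.re) / 2 := by simp
  have hA := mellin_gaussian (X := E n) (ν := volume) (t := fun x => inner ℝ x (η : E n))
    (by fun_prop) (ae_inner_ne_zero η) H.continuous.aestronglyMeasurable hs1 (by
      rw [hr2, mul_div_cancel₀ _ two_ne_zero]
      exact integrable_inner_rpow_mul H h0.le h1 η)
  have hc : Continuous (fun r : ℝ => 𝓕 H (r • (η : E n))) := by fun_prop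
  have hB := mellin_gaussian (X := ℝ) (ν := volume) (t := fun r => r)
    (by fun_prop) (Measure.ae_ne volume 0) (F := fun r => 𝓕 H (r • (η : E n)))
    hc.aestronglyMeasurable hs2 (by
      rw [hr3, mul_div_cancel₀ _ two_ne_zero, neg_sub]
      exact integrable_abs_rpow_ray (𝓕 H) η h0)
  rw [show -(2 * ((1 - a) / 2)) = a - 1 by ring] at hB
  rw [show -(2 * (a / 2)) = -a by ring] at hA
  have hAB : mellin (fun u : ℝ => ∫ x : E n,
      ((Real.exp (-(Real.pi * u * inner ℝ x (η : E n) ^ 2)) : ℝ) : ℂ) * H x) (a / 2) =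
      mellin (fun u : ℝ => ∫ r : ℝ, ((Real.exp (-(Real.pi * u * r ^ 2)) : ℝ) : ℂ) *
        𝓕 H (r • (η : E n))) ((1 - a) / 2) := by
    -- The Fourier transform inverts the parameter `u` of the Gaussian.
    rw [show (1 - a) / 2 = -((a - 1) / 2) by ring, ← mellin_comp_inv]
    refine setIntegral_congr_fun measurableSet_Ioi fun u hu => ?_
    have hu0 : (u : ℂ) ≠ 0 := Complex.ofReal_ne_zero.2 (ne_of_gt hu)
    simp only [smul_eq_mul]
    rw [integral_gaussian_inner H η hu, ← mul_assoc, ← Complex.cpow_add _ _ hu0]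
    congr 2
    ring
  rw [hA, hB] at hAB
  have hG : Complex.Gamma (a / 2) ≠ 0 := Complex.Gamma_ne_zero_of_re_pos hs1
  have hpi : (Real.pi : ℂ) ≠ 0 := Complex.ofReal_ne_zero.2 Real.pi_ne_zero
  have hp : (Real.pi : ℂ) ^ (a - 1 / 2) =
      (Real.pi : ℂ) ^ (a / 2) * (Real.pi : ℂ) ^ (-((1 - a) / 2)) := by
    rw [← Complex.cpow_add _ _ hpi]
    congr 1
    ring
  have hp2 : (Real.pi : ℂ) ^ (a / 2) * (Real.pi : ℂ) ^ (-(a / 2)) = 1 := by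
    rw [← Complex.cpow_add _ _ hpi]
    simp
  rw [hp, div_mul_eq_mul_div, eq_div_iff hG]
  linear_combination (Real.pi : ℂ) ^ (a / 2) * hAB -
    (∫ x : E n, ((|inner ℝ x (η : E n)| : ℝ) : ℂ) ^ (-a) * H x) * Complex.Gamma (a / 2) * hp2

/-! ### Homogeneous functions and the kernel -/

lemma deg_re (n : ℕ) (ν : ℂ) : (deg n ν).re = -ν.re - ((n + 1 : ℕ) : ℝ) / 2 := by
  simp [deg]

lemma homExt_smul {n : ℕ} (ν : ℂ) (h : S n → ℂ) {r : ℝ} (hr : 0 < r) (σ : S n) :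
    homExt ν h (r • (σ : E n)) = (r : ℂ) ^ deg n ν * h σ := by
  have h0 : r • (σ : E n) ≠ 0 := smul_ne_zero hr.ne' (ne_zero_of_mem_unit_sphere σ)
  have h1 : dir (r • (σ : E n)) h0 = σ := by
    ext1
    simp [dir, norm_smul, abs_of_pos hr, smul_smul, hr.ne']
  simp [homExt, h0, h1, norm_smul, abs_of_pos hr]

lemma homExt_of_ne {n : ℕ} (ν : ℂ) (h : S n → ℂ) {x : E n} (hx : x ≠ 0) :
    homExt ν h x = ((‖x‖ : ℝ) : ℂ) ^ deg n ν * h (dir x hx) := by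
  simp [homExt, hx]

lemma eq_norm_smul_dir {n : ℕ} {x : E n} (hx : x ≠ 0) : x = ‖x‖ • (dir x hx : E n) := by
  simp [dir, smul_smul, hx]

lemma exists_bound {n : ℕ} {h : S n → ℂ} (hh : Continuous h) : ∃ B : ℝ, 0 ≤ B ∧ ∀ σ, ‖h σ‖ ≤ B := by
  obtain ⟨B, hB⟩ := (isCompact_univ.image hh).isBounded.exists_norm_le
  exact ⟨max B 0, le_max_right _ _, fun σ => (hB _ ⟨σ, trivial, rfl⟩).trans (le_max_left _ _)⟩

lemma smooth_continuous {n : ℕ} (h : smooth n) : Continuous h.1 := h.2.continuous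

lemma norm_homExt_le {n : ℕ} {ν : ℂ} {h : S n → ℂ} {B : ℝ} (hB : ∀ σ, ‖h σ‖ ≤ B) {x : E n}
    (hx : x ≠ 0) : ‖homExt ν h x‖ ≤ B * ‖x‖ ^ (deg n ν).re := by
  rw [homExt_of_ne ν h hx, norm_mul, Complex.norm_cpow_eq_rpow_re_of_pos (norm_pos_iff.2 hx),
    mul_comm]
  gcongr
  exact hB _

lemma aestronglyMeasurable_homExt {n : ℕ} (ν : ℂ) {h : S n → ℂ} (hh : Continuous h) :
    AEStronglyMeasurable (homExt ν h) volume := by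
  rw [← restrict_compl_singleton (μ := (volume : Measure (E n))) 0]
  refine ContinuousOn.aestronglyMeasurable ?_ (measurableSet_singleton _).compl
  rw [continuousOn_iff_continuous_domRestrict]
  have h0 : ∀ x : ({0}ᶜ : Set (E n)), (x : E n) ≠ 0 := fun x => x.2
  have h1 : Set.domRestrict {0}ᶜ (homExt ν h) = fun x : ({0}ᶜ : Set (E n)) =>
      ((‖(x : E n)‖ : ℝ) : ℂ) ^ deg n ν * h (dir x (h0 x)) := by
    funext x
    exact homExt_of_ne ν h x.2
  rw [h1]
  refine Continuous.mul ?_ (hh.comp ?_)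
  · refine continuous_iff_continuousAt.2 fun x => ?_
    refine ContinuousAt.cpow (by fun_prop) continuousAt_const ?_
    rw [Complex.ofReal_mem_slitPlane]
    exact norm_pos_iff.2 (h0 x)
  · refine Continuous.subtype_mk ?_ _
    exact (Continuous.inv₀ (by fun_prop) fun x => norm_ne_zero_iff.2 (h0 x)).smul (by fun_prop)

lemma integrable_homExt_mul {n : ℕ} {ν : ℂ} {h : S n → ℂ} (hh : Continuous h) {ψ : E n → ℂ}
    (hψ : AEStronglyMeasurable ψ volume)
    (hi : Integrable (fun x => ‖x‖ ^ (deg n ν).re * ‖ψ x‖)) :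
    Integrable (fun x => homExt ν h x * ψ x) := by
  obtain ⟨B, -, hB⟩ := exists_bound hh
  refine (hi.const_mul B).mono' ((aestronglyMeasurable_homExt ν hh).mul hψ) ?_
  filter_upwards [Measure.ae_ne volume (0 : E n)] with x hx
  rw [norm_mul, ← mul_assoc]
  exact mul_le_mul_of_nonneg_right (norm_homExt_le hB hx) (norm_nonneg _)

lemma integrable_norm_rpow_mul {n : ℕ} {F : Type*} [NormedAddCommGroup F] [NormedSpace ℝ F]
    (ψ : 𝓢(E n, F)) {s : ℝ} (hs : -((n + 1 : ℕ) : ℝ) < s) :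
    Integrable (fun x => ‖x‖ ^ s * ‖ψ x‖) := by
  obtain ⟨k, hk⟩ := exists_nat_gt (s + (n + 1 : ℕ))
  obtain ⟨K, hK, hb⟩ := exists_weight_bound ψ k
  refine ((integrable_norm_rpow_mul_weight hs hk).const_mul K).mono' (AEStronglyMeasurable.mul
    (Measurable.aestronglyMeasurable (by fun_prop)) ψ.continuous.norm.aestronglyMeasurable)
    (.of_forall fun x => ?_)
  rw [Real.norm_of_nonneg (mul_nonneg (Real.rpow_nonneg (norm_nonneg _) _) (norm_nonneg _)),
    mul_left_comm]
  exact mul_le_mul_of_nonneg_left (hb x) (Real.rpow_nonneg (norm_nonneg _) _)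

lemma integrable_norm_rpow_mul_of_notMem_tsupport {n : ℕ} (ψ : 𝓢(E n, ℂ))
    (h0 : (0 : E n) ∉ tsupport ψ) (s : ℝ) : Integrable (fun x => ‖x‖ ^ s * ‖ψ x‖) := by
  rcases lt_or_ge 0 s with hs | hs
  · exact integrable_norm_rpow_mul ψ (by
      have : (0 : ℝ) ≤ ((n + 1 : ℕ) : ℝ) := Nat.cast_nonneg _
      linarith)
  · obtain ⟨δ, hδ, hb⟩ := Metric.isOpen_iff.1 (isClosed_tsupport ψ).isOpen_compl 0 h0
    refine (ψ.integrable (μ := volume).norm.const_mul (δ ^ s)).mono' (AEStronglyMeasurable.mul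
      (Measurable.aestronglyMeasurable (by fun_prop)) ψ.continuous.norm.aestronglyMeasurable)
      (.of_forall fun x => ?_)
    rw [Real.norm_of_nonneg (mul_nonneg (Real.rpow_nonneg (norm_nonneg _) _) (norm_nonneg _))]
    by_cases hx : ‖x‖ < δ
    · have : ψ x = 0 := image_eq_zero_of_notMem_tsupport (hb (by simpa using hx))
      simp [this]
    · exact mul_le_mul_of_nonneg_right
        (Real.rpow_le_rpow_of_nonpos hδ (not_lt.1 hx) hs) (norm_nonneg _)

/-- The pairing of a homogeneous function with `ψ` in polar coordinates is an average over the
sphere of Mellin transforms along rays. -/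
lemma integral_homExt_mul {n : ℕ} {ν : ℂ} {h : S n → ℂ} {ψ : E n → ℂ}
    (hi : Integrable (fun x => homExt ν h x * ψ x)) :
    Integrable (fun σ : S n => h σ * mellin (fun r => ψ (r • (σ : E n)))
      (deg n ν + ((n + 1 : ℕ) : ℂ))) (surf n) ∧
    ∫ x, homExt ν h x * ψ x = ∫ σ : S n, h σ * mellin (fun r => ψ (r • (σ : E n)))
      (deg n ν + ((n + 1 : ℕ) : ℂ)) ∂(surf n) := by
  have he : ∀ σ : S n, ∫ r in Ioi (0 : ℝ), r ^ n • (homExt ν h (r • (σ : E n)) * ψ (r • (σ : E n))) =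
      h σ * mellin (fun r => ψ (r • (σ : E n))) (deg n ν + ((n + 1 : ℕ) : ℂ)) := by
    intro σ
    rw [mellin, ← integral_const_mul]
    refine setIntegral_congr_fun measurableSet_Ioi fun r (hr : 0 < r) => ?_
    have hr0 : (r : ℂ) ≠ 0 := Complex.ofReal_ne_zero.2 hr.ne'
    have h1 : (r : ℂ) ^ (deg n ν + ((n + 1 : ℕ) : ℂ) - 1) = (r : ℂ) ^ deg n ν * (r : ℂ) ^ n := by
      rw [← Complex.cpow_natCast (r : ℂ) n, ← Complex.cpow_add _ _ hr0]
      congr 1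
      push_cast
      ring
    simp only [homExt_smul ν h hr, h1, Complex.real_smul, smul_eq_mul]
    push_cast
    ring
  constructor
  · refine (((integrable_polar _).1 hi).integral_prod_left).congr (.of_forall fun σ => ?_)
    exact he σ
  · rw [integral_polar hi]
    simp only [he]

/-- The integral which defines `Q_μ h`. -/
noncomputable def kernelIntegral (n : ℕ) (μ : ℂ) (h : S n → ℂ) (η : S n) : ℂ :=
  ∫ σ : S n, ((|inner ℝ (σ : E n) (η : E n)| : ℝ) : ℂ) ^ deg n μ * h σ ∂(surf n)

lemma abs_inner_le_one {n : ℕ} (σ η : S n) : |inner ℝ (σ : E n) (η : E n)| ≤ 1 := by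
  simpa using abs_real_inner_le_norm (σ : E n) (η : E n)

lemma norm_kernel_le {n : ℕ} {z : ℂ} {s : ℝ} (hs : -s ≤ z.re) (σ η : S n) :
    ‖((|inner ℝ (σ : E n) (η : E n)| : ℝ) : ℂ) ^ z‖ ≤
      1 + |inner ℝ (σ : E n) (η : E n)| ^ (-s) :=
  norm_cpow_le (abs_nonneg _) (abs_inner_le_one σ η) hs

lemma integrable_kernel {n : ℕ} {μ : ℂ} (hμ : -1 < (deg n μ).re) {h : S n → ℂ}
    (hh : Continuous h) (η : S n) :
    Integrable (fun σ : S n => ((|inner ℝ (σ : E n) (η : E n)| : ℝ) : ℂ) ^ deg n μ * h σ)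
      (surf n) := by
  obtain ⟨B, -, hB⟩ := exists_bound hh
  set s := max (-(deg n μ).re) 0
  obtain ⟨K, hK⟩ := exists_integral_sphere_kernel n (s := s) (le_max_right _ _)
    (max_lt (by linarith) zero_lt_one)
  refine (((integrable_const (1 : ℝ)).add (hK η).1).mul_const B).mono' (AEStronglyMeasurable.mul
    (Measurable.aestronglyMeasurable (by fun_prop)) hh.aestronglyMeasurable)
    (.of_forall fun σ => ?_)
  rw [norm_mul]
  have h2 := norm_kernel_le (z := deg n μ) (s := s) (by linarith [le_max_left (-(deg n μ).re) 0]) σ η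
  exact mul_le_mul h2 (hB σ) (norm_nonneg _) ((norm_nonneg _).trans h2)

lemma homExt_kernelIntegral {n : ℕ} (μ : ℂ) (h : S n → ℂ) {x : E n} (hx : x ≠ 0) :
    homExt μ (kernelIntegral n μ h) x =
      ∫ σ : S n, ((|inner ℝ (σ : E n) x| : ℝ) : ℂ) ^ deg n μ * h σ ∂(surf n) := by
  rw [homExt_of_ne _ _ hx, kernelIntegral, ← integral_const_mul]
  congr 1
  funext σ
  conv_rhs => rw [eq_norm_smul_dir hx]
  rw [real_inner_smul_right, abs_mul, abs_norm, Complex.ofReal_mul,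
    Complex.mul_cpow_ofReal_nonneg (norm_nonneg _) (abs_nonneg _), mul_assoc]

/-! ### The identity in the strip -/

/-- The constant `C_N(μ)` is twice the constant of `integral_kernel_eq_fourier` for
`a = -deg n μ`. -/
lemma C_eq (n : ℕ) (μ : ℂ) : C n μ = 2 * ((Real.pi : ℂ) ^ (-deg n μ - 1 / 2) *
    Complex.Gamma ((1 - -deg n μ) / 2) / Complex.Gamma (-deg n μ / 2)) := by
  have h1 : μ + (((n + 1 : ℕ) : ℂ) - 1) / 2 = -deg n μ - 1 / 2 := by simp [deg]; ring
  have h2 : (2 - ((n + 1 : ℕ) : ℂ) - 2 * μ) / 4 = (1 - -deg n μ) / 2 := by simp [deg]; ring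
  have h3 : (((n + 1 : ℕ) : ℂ) + 2 * μ) / 4 = -deg n μ / 2 := by simp [deg]; ring
  rw [C, h1, h2, h3]
  ring

lemma mellinConvergent_ray {n : ℕ} {F : Type*} [NormedAddCommGroup F] [NormedSpace ℂ F]
    (ψ : 𝓢(E n, F)) (η : S n) {a : ℂ} (ha : 0 < a.re) :
    MellinConvergent (fun r => ψ (r • (η : E n))) a := by
  have hc : Continuous (fun r : ℝ => ψ (r • (η : E n))) := by fun_prop
  refine Integrable.mono' (integrable_abs_rpow_ray ψ η ha).integrableOn
    (AEStronglyMeasurable.smul (Measurable.aestronglyMeasurable (by fun_prop))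
      hc.aestronglyMeasurable) ?_
  refine (ae_restrict_iff' measurableSet_Ioi).2 (.of_forall fun r (hr : 0 < r) => ?_)
  rw [norm_smul, Complex.norm_cpow_eq_rpow_re_of_pos hr, abs_of_pos hr]
  simp

lemma integral_abs_cpow_ray {n : ℕ} (ψ : 𝓢(E n, ℂ)) (η : S n) {a : ℂ} (ha : 0 < a.re) :
    ∫ r : ℝ, ((|r| : ℝ) : ℂ) ^ (a - 1) * ψ (r • (η : E n)) =
      mellin (fun r => ψ (r • (η : E n))) a + mellin (fun r => ψ (r • ((-η : S n) : E n))) a := by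
  have hc : Continuous (fun r : ℝ => ψ (r • (η : E n))) := by fun_prop
  have hi : Integrable (fun r : ℝ => ((|r| : ℝ) : ℂ) ^ (a - 1) * ψ (r • (η : E n))) := by
    refine (integrable_abs_rpow_ray ψ η ha).mono' (AEStronglyMeasurable.mul
      (Measurable.aestronglyMeasurable (by fun_prop)) hc.aestronglyMeasurable) ?_
    filter_upwards [Measure.ae_ne volume (0 : ℝ)] with r hr
    rw [norm_mul, Complex.norm_cpow_eq_rpow_re_of_pos (abs_pos.2 hr)]
    simp
  rw [← intervalIntegral.integral_Iic_add_Ioi (b := 0) hi.integrableOn hi.integrableOn, add_comm]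
  congr 1
  · refine setIntegral_congr_fun measurableSet_Ioi fun r (hr : 0 < r) => ?_
    simp [abs_of_pos hr]
  · rw [mellin, ← neg_zero, ← integral_comp_neg_Ioi, neg_zero]
    refine setIntegral_congr_fun measurableSet_Ioi fun r (hr : 0 < r) => ?_
    simp [abs_of_pos hr]

/-- The kernel `|⟨x, η⟩| ^ (-a)` integrated against a Schwartz function, in terms of the Fourier
transform on the line spanned by `η`. -/
lemma integral_kernel_eq_mellin {n : ℕ} (H : 𝓢(E n, ℂ)) (η : S n) {μ : ℂ} (h0 : (deg n μ).re < 0)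
    (h1 : -1 < (deg n μ).re) :
    ∫ x : E n, ((|inner ℝ x (η : E n)| : ℝ) : ℂ) ^ deg n μ * H x =
      C n μ / 2 * (mellin (fun r => 𝓕 H (r • (η : E n))) (-deg n μ) +
        mellin (fun r => 𝓕 H (r • ((-η : S n) : E n))) (-deg n μ)) := by
  have h0' : 0 < (-deg n μ).re := by simpa using h0
  have h := integral_kernel_eq_fourier H η h0' (by rw [Complex.neg_re]; linarith)
  rw [neg_neg] at h
  rw [h, integral_abs_cpow_ray _ _ h0', C_eq]
  ring

lemma dir_neg {n : ℕ} {x : E n} (hx : x ≠ 0) : dir (-x) (neg_ne_zero.2 hx) = -dir x hx := by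
  ext1
  simp [dir]

lemma homExt_neg {n : ℕ} (ν : ℂ) {h : S n → ℂ} (he : ∀ σ, h (-σ) = h σ) (x : E n) :
    homExt ν h (-x) = homExt ν h x := by
  by_cases hx : x = 0
  · simp [hx]
  · rw [homExt_of_ne _ _ hx, homExt_of_ne _ _ (neg_ne_zero.2 hx), dir_neg hx, he, norm_neg]

/-- The exponent of the Mellin transforms to which `integral_homExt_mul` leads for the function
`homExt (-μ) h`. -/
lemma deg_neg (n : ℕ) (μ : ℂ) : deg n (-μ) + ((n + 1 : ℕ) : ℂ) = -deg n μ := by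
  simp only [deg]
  ring

lemma integrable_homExt_mul_schwartz {n : ℕ} {ν : ℂ} (hν : -((n + 1 : ℕ) : ℝ) < (deg n ν).re)
    {h : S n → ℂ} (hh : Continuous h) (ψ : 𝓢(E n, ℂ)) :
    Integrable (fun x => homExt ν h x * ψ x) :=
  integrable_homExt_mul hh ψ.continuous.aestronglyMeasurable (integrable_norm_rpow_mul ψ hν)

/-- The identity `(Q_μ h)^(μ) = C_N(μ) 𝓕 (h^(-μ))` in the strip where all integrals converge
absolutely. -/
lemma integral_homExt_kernelIntegral {n : ℕ} {μ : ℂ} (h0 : (deg n μ).re < 0)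
    (h1 : -1 < (deg n μ).re) {h : S n → ℂ} (hh : Continuous h) (he : ∀ σ, h (-σ) = h σ)
    (φ : 𝓢(E n, ℂ)) :
    ∫ x, homExt μ (kernelIntegral n μ h) x * φ x = C n μ * ∫ x, homExt (-μ) h x * 𝓕 φ x := by
  obtain ⟨B, hB0, hB⟩ := exists_bound hh
  set s := -(deg n μ).re
  have hs0 : 0 ≤ s := by simp only [s]; linarith
  have hs1 : s < 1 := by simp only [s]; linarith
  set f : S n → E n → ℂ := fun σ x => ((|inner ℝ (σ : E n) x| : ℝ) : ℂ) ^ deg n μ * h σ * φ x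
  have hm : AEStronglyMeasurable (Function.uncurry f) ((surf n).prod volume) := by
    refine AEStronglyMeasurable.mul (AEStronglyMeasurable.mul
      (Measurable.aestronglyMeasurable ?_) ?_) ?_
    · refine Measurable.pow_const ?_ _
      exact (Continuous.measurable (by fun_prop))
    · exact hh.aestronglyMeasurable.comp_fst
    · exact φ.continuous.aestronglyMeasurable.comp_snd
  obtain ⟨K, hK, hb⟩ := exists_weight_bound φ (2 * (n + 1))
  have hfb : ∀ σ : S n, ∀ᵐ x, ‖f σ x‖ ≤
      B * K * (|inner ℝ x (σ : E n)| ^ (-s) * ((1 + ‖x‖) ^ (2 * (n + 1)))⁻¹) := by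
    intro σ
    filter_upwards [ae_inner_ne_zero σ] with x hx
    simp only [f]
    rw [real_inner_comm, norm_mul, norm_mul, Complex.norm_cpow_eq_rpow_re_of_pos (abs_pos.2 hx)]
    simp only [s, neg_neg]
    have h2 : 0 ≤ |inner ℝ x (σ : E n)| ^ (deg n μ).re := Real.rpow_nonneg (abs_nonneg _) _
    calc |inner ℝ x (σ : E n)| ^ (deg n μ).re * ‖h σ‖ * ‖φ x‖
        ≤ |inner ℝ x (σ : E n)| ^ (deg n μ).re * B * (K * ((1 + ‖x‖) ^ (2 * (n + 1)))⁻¹) := by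
          gcongr
          · exact hB σ
          · exact hb x
      _ = _ := by ring
  have hint : Integrable (Function.uncurry f) ((surf n).prod volume) := by
    rw [integrable_prod_iff hm]
    have hσ : ∀ᵐ σ ∂(surf n), Integrable (f σ) := by
      filter_upwards [hm.prodMk_left] with σ hσ
      exact ((integrable_inner_rpow hs0 hs1 σ).1.const_mul _).mono' hσ (hfb σ)
    refine ⟨hσ, ?_⟩
    refine (integrable_const (B * K *
      ∫ x : E n, |x 0| ^ (-s) * ((1 + ‖x‖) ^ (2 * (n + 1)))⁻¹)).mono'
      hm.norm.integral_prod_right' ?_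
    filter_upwards [hσ] with σ hσ
    rw [Real.norm_of_nonneg (integral_nonneg fun x => norm_nonneg _),
      ← (integrable_inner_rpow hs0 hs1 σ).2, ← integral_const_mul]
    exact integral_mono_ae hσ.norm ((integrable_inner_rpow hs0 hs1 σ).1.const_mul _) (hfb σ)
  have hL : ∫ x, homExt μ (kernelIntegral n μ h) x * φ x = ∫ σ : S n, (∫ x, f σ x) ∂(surf n) := by
    rw [integral_integral_swap hint]
    refine integral_congr_ae ?_
    filter_upwards [Measure.ae_ne volume (0 : E n)] with x hx
    rw [homExt_kernelIntegral μ h hx, ← integral_mul_const]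
  have hdeg : -((n + 1 : ℕ) : ℝ) < (deg n (-μ)).re := by
    have := congrArg Complex.re (deg_neg n μ)
    simp only [Complex.add_re, Complex.neg_re, Complex.natCast_re] at this
    linarith
  -- The Mellin transforms along opposite rays are treated separately; as `h` is even, both lead to
  -- the same integral.
  obtain ⟨hi1, hR1⟩ := integral_homExt_mul (integrable_homExt_mul_schwartz hdeg hh (𝓕 φ))
  have hi2' : Integrable (fun x => homExt (-μ) h x * 𝓕 φ (-x)) := by
    have := (integrable_homExt_mul_schwartz hdeg hh (𝓕 φ)).comp_neg
    simpa only [homExt_neg _ he] using this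
  obtain ⟨hi2, hR2⟩ := integral_homExt_mul (ψ := fun x => 𝓕 φ (-x)) hi2'
  have hR12 : ∫ x, homExt (-μ) h x * 𝓕 φ (-x) = ∫ x, homExt (-μ) h x * 𝓕 φ x := by
    rw [← integral_neg_eq_self]
    simp only [homExt_neg _ he, neg_neg]
  have hinner : ∀ σ : S n, ∫ x, f σ x = C n μ / 2 *
      (h σ * mellin (fun r => 𝓕 φ (r • (σ : E n))) (-deg n μ) +
      h σ * mellin (fun r => 𝓕 φ (-(r • (σ : E n)))) (-deg n μ)) := by
    intro σ
    have h2 := integral_kernel_eq_mellin φ σ h0 h1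
    simp only [coe_neg_sphere, smul_neg] at h2
    calc ∫ x, f σ x = ∫ x, h σ * (((|inner ℝ x (σ : E n)| : ℝ) : ℂ) ^ deg n μ * φ x) := by
          congr 1
          funext x
          simp only [f, real_inner_comm x]
          ring
      _ = _ := by
          rw [integral_const_mul, h2]
          ring
  rw [deg_neg] at hi1 hR1 hi2 hR2
  rw [hL]
  simp only [hinner]
  rw [integral_const_mul, integral_add hi1 hi2, ← hR1, ← hR2, hR12]
  ring

/-! ### Test functions on `ℝ^N` with prescribed angular part -/

/-- A bump function on the half-line `r > 0`, supported in `[1, 3]`. -/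
noncomputable def radialBump : ContDiffBump (2 : ℝ) := ⟨1 / 2, 1, by norm_num, by norm_num⟩

lemma radialBump_eq_zero {r : ℝ} (hr : r ≤ 1 ∨ 3 ≤ r) : radialBump r = 0 := by
  refine radialBump.zero_of_le_dist ?_
  rw [Real.dist_eq, show radialBump.rOut = 1 from rfl, le_abs]
  rcases hr with h | h
  · right; linarith
  · left; linarith

/-- The function `x ↦ χ(|x|) |x| ^ (-ν-N/2) h(x/|x|)`, where `χ` is the radial bump. -/
noncomputable def homCut {n : ℕ} (ν : ℂ) (h : S n → ℂ) (x : E n) : ℂ :=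
  (radialBump ‖x‖ : ℂ) * homExt ν h x

lemma homCut_eq_zero {n : ℕ} (ν : ℂ) (h : S n → ℂ) {x : E n} (hx : ‖x‖ ≤ 1 ∨ 3 ≤ ‖x‖) :
    homCut ν h x = 0 := by
  simp [homCut, radialBump_eq_zero hx]

lemma homCut_contDiff {n : ℕ} (ν : ℂ) (h : smooth n) : ContDiff ℝ ∞ (homCut ν h.1) := by
  refine contDiff_iff_contDiffAt.2 fun x => ?_
  by_cases hx : x = 0
  · subst hx
    refine (contDiffAt_const (c := (0 : ℂ))).congr_of_eventuallyEq ?_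
    filter_upwards [Metric.ball_mem_nhds (0 : E n) one_pos] with y hy
    exact homCut_eq_zero _ _ (Or.inl (by simpa using (mem_ball_zero_iff.1 hy).le))
  · have h1 : ContDiffAt ℝ ∞ (fun y : E n => (radialBump ‖y‖ : ℂ)) x :=
      Complex.ofRealCLM.contDiff.contDiffAt.comp x
        (radialBump.contDiff.contDiffAt.comp x (contDiffAt_norm ℝ hx))
    exact h1.mul (homExt_contDiffAt ν h x hx)

lemma homCut_hasCompactSupport {n : ℕ} (ν : ℂ) (h : S n → ℂ) : HasCompactSupport (homCut ν h) := by
  refine HasCompactSupport.intro (isCompact_closedBall (0 : E n) 3) fun x hx => ?_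
  exact homCut_eq_zero _ _ (Or.inr (by simpa using (not_le.1 (by simpa using hx)).le))

/-- `homCut` as a Schwartz function. -/
noncomputable def testFun {n : ℕ} (ν : ℂ) (h : smooth n) : 𝓢(E n, ℂ) :=
  (homCut_hasCompactSupport ν h.1).toSchwartzMap (homCut_contDiff ν h)

lemma testFun_apply {n : ℕ} (ν : ℂ) (h : smooth n) (x : E n) :
    testFun ν h x = homCut ν h.1 x := rfl

lemma testFun_add {n : ℕ} (ν : ℂ) (h k : smooth n) :
    testFun ν (h + k) = testFun ν h + testFun ν k := by
  ext x
  simp only [add_apply, testFun_apply, homCut]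
  by_cases hx : x = 0 <;> simp [homExt, hx, mul_add]

lemma testFun_smul {n : ℕ} (ν : ℂ) (c : ℂ) (h : smooth n) :
    testFun ν (c • h) = c • testFun ν h := by
  ext x
  simp only [smul_apply, testFun_apply, homCut]
  by_cases hx : x = 0
  · simp [homExt, hx]
  · simp [homExt, hx, mul_left_comm]

/-- The moment `∫ r ^ z χ(r) dr` of the radial bump. -/
noncomputable def moment (z : ℂ) : ℂ := ∫ r in Ioi (0 : ℝ), (r : ℂ) ^ z * (radialBump r : ℂ)

lemma moment_zero_ne_zero : moment 0 ≠ 0 := by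
  have h1 : moment 0 = ((∫ r : ℝ, radialBump r : ℝ) : ℂ) := by
    rw [moment, ← integral_complex_ofReal, setIntegral_eq_integral_of_forall_compl_eq_zero]
    · simp
    · intro r hr
      simp [radialBump_eq_zero (Or.inl ((not_lt.1 hr).trans zero_le_one))]
  rw [h1]
  exact Complex.ofReal_ne_zero.2 radialBump.integral_pos.ne'

lemma moment_differentiable : Differentiable ℂ moment := by
  intro z₀
  have hi : Integrable (fun r : ℝ => (3 : ℝ) ^ (‖z₀‖ + 1) * radialBump r)
      (volume.restrict (Ioi 0)) :=
    (radialBump.integrable.const_mul _).integrableOn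
  have hc : Continuous (fun r : ℝ => (radialBump r : ℂ)) :=
    Complex.continuous_ofReal.comp radialBump.continuous
  have h := differentiableOn_integral_of_dominated (ν := volume.restrict (Ioi (0 : ℝ)))
    (U := ball z₀ 1) isOpen_ball (F := fun z r => (r : ℂ) ^ z * (radialBump r : ℂ))
    (g := fun r => (3 : ℝ) ^ (‖z₀‖ + 1) * radialBump r)
    (fun z _ => AEStronglyMeasurable.mul (Measurable.aestronglyMeasurable (by fun_prop))
      hc.aestronglyMeasurable) ?_ hi ?_
  · exact h.differentiableAt (ball_mem_nhds z₀ one_pos)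
  · refine (ae_restrict_iff' measurableSet_Ioi).2 (.of_forall fun r (hr : 0 < r) => ?_)
    simp only [cpow_eq_exp hr]
    fun_prop
  · refine (ae_restrict_iff' measurableSet_Ioi).2 (.of_forall fun r (hr : 0 < r) z hz => ?_)
    rw [norm_mul, Complex.norm_cpow_eq_rpow_re_of_pos hr, Complex.norm_real,
      Real.norm_of_nonneg radialBump.nonneg]
    by_cases h1 : r ≤ 1 ∨ 3 ≤ r
    · simp [radialBump_eq_zero h1]
    · push Not at h1
      refine mul_le_mul_of_nonneg_right ?_ radialBump.nonneg
      have hz' : z.re ≤ ‖z₀‖ + 1 := by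
        have h2 := Complex.re_le_norm z
        have h3 := norm_le_norm_add_norm_sub' z z₀
        rw [mem_ball, dist_eq_norm] at hz
        linarith
      calc r ^ z.re ≤ r ^ (‖z₀‖ + 1) := Real.rpow_le_rpow_of_exponent_le h1.1.le hz'
        _ ≤ 3 ^ (‖z₀‖ + 1) := Real.rpow_le_rpow hr.le h1.2.le (by positivity)

/-- Integrating the kernel against a test function with angular part `h` gives a multiple of the
integral over the sphere. -/
lemma integral_kernel_testFun {n : ℕ} (μ ν : ℂ) (h : smooth n) (η : S n) :
    ∫ x : E n, ((|inner ℝ x (η : E n)| : ℝ) : ℂ) ^ deg n μ * testFun ν h x =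
      moment (deg n μ + deg n ν + n) * kernelIntegral n μ h.1 η := by
  rw [integral_polarMeasure, moment, kernelIntegral, mul_comm, ← integral_prod_mul]
  refine integral_congr_ae ?_
  have h5 : ∀ᵐ p ∂(polarMeasure n), p.2 ∈ Ioi (0 : ℝ) :=
    Measure.quasiMeasurePreserving_snd.ae (ae_restrict_mem measurableSet_Ioi)
  filter_upwards [h5] with p (hp : 0 < p.2)
  have hp0 : (p.2 : ℂ) ≠ 0 := Complex.ofReal_ne_zero.2 hp.ne'
  rw [testFun_apply, homCut, homExt_smul ν h.1 hp, real_inner_smul_left, abs_mul, abs_of_pos hp,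
    Complex.ofReal_mul, Complex.mul_cpow_ofReal_nonneg hp.le (abs_nonneg _), norm_smul,
    Real.norm_of_nonneg hp.le, norm_eq_of_mem_sphere, mul_one, Complex.cpow_add _ _ hp0,
    Complex.cpow_add _ _ hp0, Complex.cpow_natCast, Complex.real_smul]
  push_cast
  ring

/-- The test function `testFun (-μ₁ - 1) h` is normalized so that, by `integral_kernel_testFun`, its
scalar is `moment (μ₁ - μ)`, which is not zero for `μ` near `μ₁`. -/
lemma deg_add_deg (n : ℕ) (μ μ₁ : ℂ) : deg n μ + deg n (-μ₁ - 1) + n = μ₁ - μ := by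
  simp only [deg]
  push_cast
  ring

/-! ### Smoothness of the kernel integral -/

lemma locallyIntegrable_kernel {n : ℕ} {z : ℂ} (hz : -1 < z.re) (η : S n) :
    LocallyIntegrable (fun x : E n => ((|inner ℝ x (η : E n)| : ℝ) : ℂ) ^ z) := by
  set s := max (-z.re) 0
  set p := max z.re 0
  have hsp : z.re = -s + p := by
    rcases le_total z.re 0 with h | h
    · simp [s, p, h]
    · simp [s, p, h]
  have hs := (integrable_inner_rpow (σ := s) (le_max_right _ _) (max_lt (by linarith) zero_lt_one)
    η).1
  have hc : Continuous (fun x : E n => (1 + ‖x‖) ^ (2 * (n + 1)) * (1 + ‖x‖) ^ p) := by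
    refine Continuous.mul (by fun_prop) (Continuous.rpow_const (by fun_prop) fun x => ?_)
    exact Or.inr (le_max_right _ _)
  refine (hs.locallyIntegrable.mul_continuous hc).mono
    (Measurable.aestronglyMeasurable (by fun_prop)) ?_
  filter_upwards [ae_inner_ne_zero η] with x hx
  have h0 : 0 < |inner ℝ x (η : E n)| := abs_pos.2 hx
  have h1 : |inner ℝ x (η : E n)| ≤ 1 + ‖x‖ := by
    have := abs_real_inner_le_norm x (η : E n)
    rw [norm_eq_of_mem_sphere, mul_one] at this
    linarith
  have h2 : (1 + ‖x‖) ^ (2 * (n + 1)) ≠ 0 := by positivity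
  rw [Complex.norm_cpow_eq_rpow_re_of_pos h0, mul_assoc, inv_mul_cancel_left₀ h2,
    Real.norm_of_nonneg (by positivity), hsp, Real.rpow_add h0]
  exact mul_le_mul_of_nonneg_left (Real.rpow_le_rpow h0.le h1 (le_max_right _ _)) (by positivity)

/-- As a function of `v ≠ 0` and `x`, the reflection of `x` in the hyperplane `v^⊥` is smooth. -/
lemma contDiffOn_reflection {n : ℕ} (e : E n) :
    ContDiffOn ℝ ∞ (fun q : E n × E n => (ℝ ∙ (e - q.1))ᗮ.reflection (-q.2)) ({e}ᶜ ×ˢ univ) := by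
  rintro ⟨η, x⟩ ⟨hη, -⟩
  have h0 : e - η ≠ 0 := sub_ne_zero.2 (Ne.symm hη)
  have hf : (fun q : E n × E n => (ℝ ∙ (e - q.1))ᗮ.reflection (-q.2)) = fun q =>
      (2 : ℝ) • (inner ℝ (e - q.1) q.2 / ‖e - q.1‖ ^ 2) • (e - q.1) - q.2 := by
    funext q
    rw [map_neg, Submodule.reflection_orthogonal_apply, neg_neg,
      Submodule.reflection_singleton_apply]
    simp [two_smul]
  rw [hf]
  have h1 : ContDiffAt ℝ ∞ (fun q : E n × E n => e - q.1) (η, x) := by fun_prop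
  have h2 : ContDiffAt ℝ ∞ (fun q : E n × E n => inner ℝ (e - q.1) q.2) (η, x) :=
    h1.inner ℝ contDiffAt_snd
  have h3 : ContDiffAt ℝ ∞ (fun q : E n × E n => ‖e - q.1‖ ^ 2) (η, x) := h1.norm_sq ℝ
  have h4 : ‖e - (η, x).1‖ ^ 2 ≠ 0 := pow_ne_zero 2 (norm_ne_zero_iff.2 h0)
  have h5 := ((h2.div h3 h4).smul h1).const_smul (2 : ℝ)
  exact (h5.sub contDiffAt_snd).contDiffWithinAt

/-- Integrals of a compactly supported smooth function against the kernel `|⟨x, η⟩| ^ z` are smooth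
in `η`. Near `η₀` the reflection which exchanges `η` and `-η₀` moves the dependence on `η` from the
singular kernel to the smooth function. -/
lemma contMDiff_integral_kernel {n : ℕ} {z : ℂ} (hz : -1 < z.re) {H : E n → ℂ}
    (hH : ContDiff ℝ ∞ H) (hs : HasCompactSupport H) :
    ContMDiff (𝓡 n) 𝓘(ℝ, ℂ) ∞
      (fun η : S n => ∫ x : E n, ((|inner ℝ x (η : E n)| : ℝ) : ℂ) ^ z * H x) := by
  intro η₀
  let e : S n := -η₀
  obtain ⟨R, hR⟩ := hs.isCompact.isBounded.exists_norm_le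
  let g : E n → E n → ℂ := fun η x => H ((ℝ ∙ ((e : E n) - η))ᗮ.reflection (-x))
  have hg : ContDiffOn ℝ ∞ ↿g ({(e : E n)}ᶜ ×ˢ univ) :=
    hH.comp_contDiffOn (contDiffOn_reflection (e : E n))
  have hgs : ∀ p, ∀ x, p ∈ ({(e : E n)}ᶜ : Set (E n)) → x ∉ closedBall (0 : E n) R → g p x = 0 := by
    intro p x _ hx
    refine image_eq_zero_of_notMem_tsupport (f := H) fun h => hx ?_
    simpa using hR _ h
  -- The integral is the value at `0` of the convolution of the kernel for the fixed vector `e` with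
  -- `g η`.
  have hconv := contDiffOn_convolution_right_with_param_comp (n := ⊤) (μ := volume)
    (ContinuousLinearMap.mul ℝ ℂ) (v := fun _ => (0 : E n)) contDiffOn_const
    isOpen_compl_singleton (isCompact_closedBall (0 : E n) R) hgs (locallyIntegrable_kernel hz e) hg
  have hne : (η₀ : E n) ∈ ({(e : E n)}ᶜ : Set (E n)) := by
    intro h
    have h1 : (η₀ : E n) = -(η₀ : E n) := by simpa [e] using h
    have h2 : (2 : ℝ) • (η₀ : E n) = 0 := by
      rw [two_smul]
      exact eq_neg_iff_add_eq_zero.1 h1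
    exact ne_zero_of_mem_unit_sphere η₀ ((smul_eq_zero.1 h2).resolve_left two_ne_zero)
  have hat := (hconv.contDiffAt (isOpen_compl_singleton.mem_nhds hne)).contMDiffAt.comp η₀
    (contMDiff_coe_sphere (n := n) η₀)
  refine hat.congr_of_eventuallyEq (.of_forall fun η => ?_)
  simp only [Function.comp_apply, convolution_def, ContinuousLinearMap.mul_apply', zero_sub, g,
    neg_neg]
  let L := (ℝ ∙ ((e : E n) - η))ᗮ.reflection
  have hL : L e = η := Submodule.reflection_sub (by simp)
  rw [← L.measurePreserving.integral_comp L.toHomeomorph.measurableEmbedding]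
  refine integral_congr_ae (.of_forall fun x => ?_)
  have h2 : inner ℝ (L x) (η : E n) = inner ℝ x (e : E n) := by rw [← hL, L.inner_map_map]
  simp only [L] at h2
  simp only [L, h2]

lemma kernelIntegral_eq {n : ℕ} (μ : ℂ) (h : smooth n) (η : S n) :
    kernelIntegral n μ h.1 η = (moment 0)⁻¹ *
      ∫ x : E n, ((|inner ℝ x (η : E n)| : ℝ) : ℂ) ^ deg n μ * testFun (-μ - 1) h x := by
  rw [integral_kernel_testFun, deg_add_deg, sub_self, inv_mul_cancel_left₀ moment_zero_ne_zero]

lemma kernelIntegral_contMDiff {n : ℕ} {μ : ℂ} (hμ : -1 < (deg n μ).re) (h : smooth n) :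
    ContMDiff (𝓡 n) 𝓘(ℝ, ℂ) ∞ (kernelIntegral n μ h.1) := by
  have h1 := contMDiff_integral_kernel hμ (homCut_contDiff (-μ - 1) h)
    (homCut_hasCompactSupport (-μ - 1) h.1)
  have h2 : kernelIntegral n μ h.1 = (moment 0)⁻¹ • fun η : S n =>
      ∫ x : E n, ((|inner ℝ x (η : E n)| : ℝ) : ℂ) ^ deg n μ * homCut (-μ - 1) h.1 x := by
    funext η
    exact kernelIntegral_eq μ h η
  rw [h2]
  exact (smooth n).smul_mem _ h1

/-! ### Mellin transforms along rays -/

/-- A majorant for the integrand of the Mellin transform along rays, locally uniform in the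
direction of the ray and in the exponent. -/
lemma exists_ray_bound {n : ℕ} {F : Type*} [NormedAddCommGroup F] [NormedSpace ℝ F]
    (ψ : 𝓢(E n, F)) {s₀ s₁ δ : ℝ} (hs : 0 < s₀) (hδ : 0 < δ) :
    ∃ g : ℝ → ℝ, IntegrableOn g (Ioi 0) ∧ ∀ s ∈ Icc s₀ s₁, ∀ η : E n, δ ≤ ‖η‖ → ∀ r > 0,
      r ^ (s - 1) * ‖ψ (r • η)‖ ≤ g r := by
  obtain ⟨k, hk⟩ := exists_nat_gt (max s₀ s₁)
  obtain ⟨K, hK, hb⟩ := exists_weight_bound ψ k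
  rcases lt_or_ge s₁ s₀ with h01 | h01
  · exact ⟨0, integrableOn_zero, fun s hs => absurd (hs.1.trans hs.2) (not_le.2 h01)⟩
  set m := min δ 1
  have hm : 0 < m := lt_min hδ one_pos
  refine ⟨fun r => K * (m ^ k)⁻¹ * (r ^ (s₀ - 1) * ((1 + r) ^ k)⁻¹ +
    r ^ (s₁ - 1) * ((1 + r) ^ k)⁻¹), ?_, fun s hss η hη r hr => ?_⟩
  · exact ((integrableOn_rpow_mul_weight hs ((le_max_left _ _).trans_lt hk)).add
      (integrableOn_rpow_mul_weight (hs.trans_le h01) ((le_max_right _ _).trans_lt hk))).const_mul _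
  · have h1 : r ^ (s - 1) ≤ r ^ (s₀ - 1) + r ^ (s₁ - 1) := by
      have p0 := Real.rpow_pos_of_pos hr (s₀ - 1)
      have p1 := Real.rpow_pos_of_pos hr (s₁ - 1)
      rcases le_total r 1 with h | h
      · have := Real.rpow_le_rpow_of_exponent_ge hr h (sub_le_sub_right hss.1 1)
        linarith
      · have := Real.rpow_le_rpow_of_exponent_le h (sub_le_sub_right hss.2 1)
        linarith
    have h2 : ‖ψ (r • η)‖ ≤ K * ((m ^ k)⁻¹ * ((1 + r) ^ k)⁻¹) := by
      refine (hb _).trans (mul_le_mul_of_nonneg_left ?_ hK)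
      rw [← mul_inv, ← mul_pow]
      refine inv_anti₀ (by positivity) (pow_le_pow_left₀ (by positivity) ?_ k)
      rw [norm_smul, Real.norm_of_nonneg hr.le]
      nlinarith [min_le_left δ 1, min_le_right δ 1]
    calc r ^ (s - 1) * ‖ψ (r • η)‖
        ≤ (r ^ (s₀ - 1) + r ^ (s₁ - 1)) * (K * ((m ^ k)⁻¹ * ((1 + r) ^ k)⁻¹)) := by
          gcongr
      _ = _ := by ring

lemma aestronglyMeasurable_ray {n : ℕ} {F : Type*} [NormedAddCommGroup F] [NormedSpace ℂ F]
    (ψ : 𝓢(E n, F)) (η : E n) (a : ℂ) :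
    AEStronglyMeasurable (fun r : ℝ => (r : ℂ) ^ (a - 1) • ψ (r • η))
      (volume.restrict (Ioi 0)) := by
  have hc : Continuous (fun r : ℝ => ψ (r • η)) := by fun_prop
  exact AEStronglyMeasurable.smul (Measurable.aestronglyMeasurable (by fun_prop))
      hc.aestronglyMeasurable

/-- The derivative of a Mellin transform along rays is again a Mellin transform along rays. -/
lemma hasFDerivAt_mellin_ray {n : ℕ} {F : Type*} [NormedAddCommGroup F] [NormedSpace ℂ F]
    (ψ : 𝓢(E n, F)) {a : ℂ} (ha : 0 < a.re) {η : E n} (hη : η ≠ 0) :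
    HasFDerivAt (fun ξ : E n => mellin (fun r => ψ (r • ξ)) a)
      (mellin (fun r => SchwartzMap.fderivCLM ℝ (E n) F ψ (r • η)) (a + 1)) η := by
  have hη' : 0 < ‖η‖ / 2 := half_pos (norm_pos_iff.2 hη)
  have hball : ∀ ξ ∈ ball η (‖η‖ / 2), ‖η‖ / 2 ≤ ‖ξ‖ := fun ξ hξ => by
    rw [mem_ball, dist_eq_norm] at hξ
    linarith [norm_le_norm_add_norm_sub ξ η]
  obtain ⟨g, hg, hgb⟩ := exists_ray_bound ψ (s₁ := a.re) ha hη'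
  obtain ⟨g', hg', hgb'⟩ := exists_ray_bound (SchwartzMap.fderivCLM ℝ (E n) F ψ)
    (s₀ := a.re + 1) (s₁ := a.re + 1) (by linarith) hη'
  have hpow : ∀ r : ℝ, 0 < r → ∀ b : ℂ, ‖(r : ℂ) ^ (b - 1)‖ = r ^ (b.re - 1) := fun r hr b => by
    rw [Complex.norm_cpow_eq_rpow_re_of_pos hr]
    simp
  refine hasFDerivAt_integral_of_dominated_of_fderiv_le (μ := volume.restrict (Ioi (0 : ℝ)))
    (F := fun ξ r => (r : ℂ) ^ (a - 1) • ψ (r • ξ))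
    (F' := fun ξ r => (r : ℂ) ^ (a + 1 - 1) • SchwartzMap.fderivCLM ℝ (E n) F ψ (r • ξ))
    (ball_mem_nhds η hη') (.of_forall fun ξ => aestronglyMeasurable_ray ψ ξ a) ?_
    (aestronglyMeasurable_ray _ η (a + 1)) (bound := g') ?_ hg' ?_
  · refine hg.mono' (aestronglyMeasurable_ray ψ η a) ?_
    refine (ae_restrict_iff' measurableSet_Ioi).2 (.of_forall fun r (hr : 0 < r) => ?_)
    rw [norm_smul, hpow r hr]
    exact hgb a.re ⟨le_rfl, le_rfl⟩ η (by linarith) r hr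
  · refine (ae_restrict_iff' measurableSet_Ioi).2 (.of_forall fun r (hr : 0 < r) ξ hξ => ?_)
    rw [norm_smul, hpow r hr]
    exact hgb' _ (by simp) ξ (hball ξ hξ) r hr
  · refine (ae_restrict_iff' measurableSet_Ioi).2 (.of_forall fun r (hr : 0 < r) ξ hξ => ?_)
    have h1 : HasFDerivAt (fun ξ : E n => ψ (r • ξ))
        ((fderiv ℝ ψ (r • ξ)).comp (r • ContinuousLinearMap.id ℝ (E n))) ξ :=
      HasFDerivAt.comp ξ (ψ.differentiableAt.hasFDerivAt) ((hasFDerivAt_id ξ).const_smul r)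
    have h2 : HasFDerivAt (fun ξ : E n => (r : ℂ) ^ (a - 1) • ψ (r • ξ)) _ ξ :=
      h1.const_smul ((r : ℂ) ^ (a - 1))
    refine h2.congr_fderiv ?_
    have hr0 : (r : ℂ) ≠ 0 := Complex.ofReal_ne_zero.2 hr.ne'
    ext v
    rw [show a + 1 - 1 = a - 1 + 1 by ring, Complex.cpow_add _ _ hr0, Complex.cpow_one]
    simp [SchwartzMap.fderivCLM_apply, mul_smul]

/-- The codomain `F` varies in the induction, as the derivative of `ψ` takes values in the linear
maps to `F`. -/
lemma contDiffOn_mellin_ray {n : ℕ} (k : ℕ) : ∀ {F : Type} [NormedAddCommGroup F]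
    [NormedSpace ℂ F] (ψ : 𝓢(E n, F)) {a : ℂ}, 0 < a.re →
    ContDiffOn ℝ k (fun ξ : E n => mellin (fun r => ψ (r • ξ)) a) {0}ᶜ := by
  induction k with
  | zero =>
    intro F _ _ ψ a ha
    exact contDiffOn_zero.2 fun η hη =>
      (hasFDerivAt_mellin_ray ψ ha hη).continuousAt.continuousWithinAt
  | succ k ih =>
    intro F _ _ ψ a ha
    push_cast
    rw [contDiffOn_succ_iff_fderiv_of_isOpen isOpen_compl_singleton]
    refine ⟨fun η hη => (hasFDerivAt_mellin_ray ψ ha hη).differentiableAt.differentiableWithinAt,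
      by simp, ?_⟩
    refine (ih (SchwartzMap.fderivCLM ℝ (E n) F ψ) (a := a + 1) (by simp; linarith)).congr ?_
    exact fun η hη => (hasFDerivAt_mellin_ray ψ ha hη).fderiv

lemma contMDiff_mellin_ray {n : ℕ} (ψ : 𝓢(E n, ℂ)) {a : ℂ} (ha : 0 < a.re) :
    ContMDiff (𝓡 n) 𝓘(ℝ, ℂ) ∞ (fun η : S n => mellin (fun r => ψ (r • (η : E n))) a) := by
  intro η
  have h0 : (η : E n) ≠ 0 := ne_zero_of_mem_unit_sphere η
  have h1 : ContDiffOn ℝ ∞ (fun ξ : E n => mellin (fun r => ψ (r • ξ)) a) {0}ᶜ :=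
    contDiffOn_infty.2 fun k => contDiffOn_mellin_ray k ψ ha
  exact (h1.contDiffAt (isOpen_compl_singleton.mem_nhds h0)).contMDiffAt.comp η
    (contMDiff_coe_sphere (n := n) η)

/-! ### Holomorphic families of functions on the sphere -/

/-- `k` is a family of continuous functions on the sphere, bounded uniformly for `μ` near `μ₀`, and
holomorphic in `μ` near `μ₀` at each point of the sphere. -/
def IsHolomorphicFamilyAt {n : ℕ} (k : ℂ → S n → ℂ) (μ₀ : ℂ) : Prop :=
  ∃ U : Set ℂ, IsOpen U ∧ μ₀ ∈ U ∧ (∀ μ ∈ U, Continuous (k μ)) ∧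
    (∃ B : ℝ, ∀ μ ∈ U, ∀ η, ‖k μ η‖ ≤ B) ∧ ∀ η, DifferentiableOn ℂ (fun μ => k μ η) U

namespace IsHolomorphicFamilyAt

variable {n : ℕ} {k l : ℂ → S n → ℂ} {μ₀ : ℂ}

lemma const {h : S n → ℂ} (hh : Continuous h) : IsHolomorphicFamilyAt (fun _ => h) μ₀ := by
  obtain ⟨B, -, hB⟩ := exists_bound hh
  exact ⟨univ, isOpen_univ, trivial, fun _ _ => hh, ⟨B, fun _ _ => hB⟩,
    fun η => differentiableOn_const _⟩

lemma congr (hk : IsHolomorphicFamilyAt k μ₀) (h : ∀ᶠ μ in nhds μ₀, l μ = k μ) :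
    IsHolomorphicFamilyAt l μ₀ := by
  obtain ⟨U, hU, hμ, hc, ⟨B, hB⟩, hd⟩ := hk
  obtain ⟨V, hVs, hV, hμV⟩ := _root_.eventually_nhds_iff.1 h
  refine ⟨U ∩ V, hU.inter hV, ⟨hμ, hμV⟩, fun μ hm => hVs μ hm.2 ▸ hc μ hm.1,
    ⟨B, fun μ hm η => hVs μ hm.2 ▸ hB μ hm.1 η⟩, fun η => ?_⟩
  exact ((hd η).mono inter_subset_left).congr fun μ hm => congrFun (hVs μ hm.2) η

lemma add (hk : IsHolomorphicFamilyAt k μ₀) (hl : IsHolomorphicFamilyAt l μ₀) :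
    IsHolomorphicFamilyAt (fun μ η => k μ η + l μ η) μ₀ := by
  obtain ⟨U, hU, hμ, hc, ⟨B, hB⟩, hd⟩ := hk
  obtain ⟨V, hV, hμ', hc', ⟨B', hB'⟩, hd'⟩ := hl
  exact ⟨U ∩ V, hU.inter hV, ⟨hμ, hμ'⟩, fun μ hm => (hc μ hm.1).add (hc' μ hm.2),
    ⟨B + B', fun μ hm η => (norm_add_le _ _).trans (add_le_add (hB μ hm.1 η) (hB' μ hm.2 η))⟩,
    fun η => ((hd η).mono inter_subset_left).add ((hd' η).mono inter_subset_right)⟩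

lemma mul_analytic (hk : IsHolomorphicFamilyAt k μ₀) {c : ℂ → ℂ} (hc : AnalyticAt ℂ c μ₀) :
    IsHolomorphicFamilyAt (fun μ η => c μ * k μ η) μ₀ := by
  obtain ⟨U, hU, hμ, hck, ⟨B, hB⟩, hd⟩ := hk
  have h1 : ∀ᶠ μ in nhds μ₀, ‖c μ‖ < ‖c μ₀‖ + 1 :=
    hc.continuousAt.norm.eventually_lt_const (by linarith)
  obtain ⟨V, hVs, hV, hμV⟩ := _root_.eventually_nhds_iff.1 (hc.eventually_analyticAt.and h1)
  refine ⟨U ∩ V, hU.inter hV, ⟨hμ, hμV⟩, fun μ hm => continuous_const.mul (hck μ hm.1),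
    ⟨(‖c μ₀‖ + 1) * B, fun μ hm η => ?_⟩, fun η => ?_⟩
  · rw [norm_mul]
    exact mul_le_mul (hVs μ hm.2).2.le (hB μ hm.1 η) (norm_nonneg _) (by positivity)
  · exact DifferentiableOn.mul
      (fun μ hm => (hVs μ hm.2).1.differentiableAt.differentiableWithinAt)
      ((hd η).mono inter_subset_left)

lemma comp_neg_sphere (hk : IsHolomorphicFamilyAt k μ₀) :
    IsHolomorphicFamilyAt (fun μ η => k μ (-η)) μ₀ := by
  obtain ⟨U, hU, hμ, hc, ⟨B, hB⟩, hd⟩ := hk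
  exact ⟨U, hU, hμ, fun μ hm => (hc μ hm).comp continuous_neg, ⟨B, fun μ hm η => hB μ hm _⟩,
    fun η => hd _⟩

lemma comp_neg (hk : IsHolomorphicFamilyAt k (-μ₀)) :
    IsHolomorphicFamilyAt (fun μ => k (-μ)) μ₀ := by
  obtain ⟨U, hU, hμ, hc, ⟨B, hB⟩, hd⟩ := hk
  exact ⟨Neg.neg ⁻¹' U, hU.preimage continuous_neg, hμ, fun μ hm => hc _ hm,
    ⟨B, fun μ hm => hB _ hm⟩, fun η => (hd η).comp differentiable_neg.differentiableOn fun _ h => h⟩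

lemma analyticAt (hk : IsHolomorphicFamilyAt k μ₀) (η : S n) :
    AnalyticAt ℂ (fun μ => k μ η) μ₀ := by
  obtain ⟨U, hU, hμ, -, -, hd⟩ := hk
  exact (hd η).analyticAt (hU.mem_nhds hμ)

end IsHolomorphicFamilyAt

lemma continuous_deg_re (n : ℕ) : Continuous (fun μ : ℂ => (deg n μ).re) := by
  unfold deg
  fun_prop

lemma differentiable_deg (n : ℕ) : Differentiable ℂ (deg n) := by
  unfold deg
  fun_prop

lemma isHolomorphicFamilyAt_mellin_ray {n : ℕ} (ψ : 𝓢(E n, ℂ)) {μ₀ : ℂ} (h0 : (deg n μ₀).re < 0) :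
    IsHolomorphicFamilyAt
      (fun μ (η : S n) => mellin (fun r => ψ (r • (η : E n))) (-deg n μ)) μ₀ := by
  set d := (deg n μ₀).re
  obtain ⟨g, hg, hgb⟩ := exists_ray_bound ψ (s₀ := -d / 2) (s₁ := -2 * d) (δ := 1) (by linarith)
    one_pos
  let U := (fun μ : ℂ => (deg n μ).re) ⁻¹' Ioo (2 * d) (d / 2)
  have hU : IsOpen U := isOpen_Ioo.preimage (continuous_deg_re n)
  have hre : ∀ μ ∈ U, (-deg n μ).re ∈ Icc (-d / 2) (-2 * d) := fun μ hm => by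
    rw [Complex.neg_re]
    exact ⟨by linarith [hm.2], by linarith [hm.1]⟩
  have hb : ∀ η : S n, ∀ μ ∈ U, ∀ r ∈ Ioi (0 : ℝ),
      ‖(r : ℂ) ^ (-deg n μ - 1) • ψ (r • (η : E n))‖ ≤ g r := fun η μ hm r hr => by
    rw [norm_smul, Complex.norm_cpow_eq_rpow_re_of_pos hr, Complex.sub_re, Complex.one_re]
    exact hgb _ (hre μ hm) η (by simp) r hr
  refine ⟨U, hU, ⟨by linarith, by linarith⟩, fun μ hm => ?_, ⟨∫ r in Ioi 0, g r, fun μ hm η => ?_⟩,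
    fun η => ?_⟩
  · exact (contMDiff_mellin_ray ψ (by linarith [(hre μ hm).1])).continuous
  · refine norm_integral_le_of_norm_le hg ?_
    exact (ae_restrict_iff' measurableSet_Ioi).2 (.of_forall fun r hr => hb η μ hm r hr)
  · refine differentiableOn_integral_of_dominated hU
      (fun μ _ => aestronglyMeasurable_ray ψ η _) ?_ hg ?_
    · refine (ae_restrict_iff' measurableSet_Ioi).2 (.of_forall fun r hr => ?_)
      simp only [cpow_eq_exp hr]
      have := differentiable_deg n
      exact Differentiable.differentiableOn (by fun_prop)
    · exact (ae_restrict_iff' measurableSet_Ioi).2 (.of_forall fun r hr μ hm => hb η μ hm r hr)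

lemma ae_inner_ne_zero_sphere {n : ℕ} (η : S n) :
    ∀ᵐ σ : S n ∂(surf n), inner ℝ (σ : E n) (η : E n) ≠ 0 := by
  have hs : MeasurableSet {σ : S n | inner ℝ (σ : E n) (η : E n) = 0} :=
    (isClosed_eq (by fun_prop) continuous_const).measurableSet
  have h : (surf n) {σ : S n | inner ℝ (σ : E n) (η : E n) = 0} = 0 := by
    rw [Measure.toSphere_apply' _ hs]
    refine mul_eq_zero_of_right _ (measure_mono_null ?_ (ae_iff.1 (ae_inner_ne_zero η)))
    rintro _ ⟨r, -, _, ⟨σ, hσ, rfl⟩, rfl⟩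
    simpa [real_inner_smul_left] using Or.inr hσ
  simpa [ae_iff] using h

/-- The operators with kernel `|⟨σ, η⟩| ^ (-μ - N/2)` carry holomorphic families to holomorphic
families, where the integral converges. -/
lemma isHolomorphicFamilyAt_kernelIntegral {n : ℕ} {k : ℂ → S n → ℂ} {μ₀ : ℂ}
    (hk : IsHolomorphicFamilyAt k μ₀) (h1 : -1 < (deg n μ₀).re)
    (hc : ∀ᶠ μ in nhds μ₀, Continuous (kernelIntegral n μ (k μ))) :
    IsHolomorphicFamilyAt (fun μ => kernelIntegral n μ (k μ)) μ₀ := by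
  obtain ⟨U, hU, hμ, hck, ⟨B, hB⟩, hd⟩ := hk
  obtain ⟨V, hVs, hV, hμV⟩ := _root_.eventually_nhds_iff.1 hc
  set d := (deg n μ₀).re
  set s := max ((1 - d) / 2) 0
  have hs0 : 0 ≤ s := le_max_right _ _
  have hs1 : s < 1 := max_lt (by linarith) one_pos
  have hsd : (1 - d) / 2 ≤ s := le_max_left _ _
  obtain ⟨K, hK⟩ := exists_integral_sphere_kernel n hs0 hs1
  let W := (fun μ : ℂ => (deg n μ).re) ⁻¹' Ioi (-s)
  have hW : IsOpen W := isOpen_Ioi.preimage (continuous_deg_re n)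
  have hbd : ∀ η σ : S n, ∀ μ ∈ U ∩ V ∩ W,
      ‖((|inner ℝ (σ : E n) (η : E n)| : ℝ) : ℂ) ^ deg n μ * k μ σ‖ ≤
        (1 + |inner ℝ (σ : E n) (η : E n)| ^ (-s)) * B := fun η σ μ hm => by
    rw [norm_mul]
    have h2 := norm_kernel_le (z := deg n μ) (s := s) (le_of_lt hm.2) σ η
    exact mul_le_mul h2 (hB μ hm.1.1 σ) (norm_nonneg _) ((norm_nonneg _).trans h2)
  have hint : ∀ η : S n, Integrable
      (fun σ : S n => (1 + |inner ℝ (σ : E n) (η : E n)| ^ (-s)) * B) (surf n) := fun η =>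
    ((integrable_const (1 : ℝ)).add (hK η).1).mul_const B
  refine ⟨U ∩ V ∩ W, (hU.inter hV).inter hW, ⟨⟨hμ, hμV⟩, ?_⟩, fun μ hm => hVs μ hm.1.2,
    ⟨((surf n).real univ + K) * B, fun μ hm η => ?_⟩, fun η => ?_⟩
  · change -s < d
    linarith
  · refine (norm_integral_le_of_norm_le (hint η) (.of_forall fun σ => hbd η σ μ hm)).trans_eq ?_
    rw [integral_mul_const, integral_add (integrable_const _) (hK η).1, (hK η).2]
    simp
  · refine differentiableOn_integral_of_dominated ((hU.inter hV).inter hW)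
      (fun μ hm => ?_) ?_ (hint η) (.of_forall fun σ μ hm => hbd η σ μ hm)
    · exact AEStronglyMeasurable.mul (Measurable.aestronglyMeasurable (by fun_prop))
        (hck μ hm.1.1).aestronglyMeasurable
    · filter_upwards [ae_inner_ne_zero_sphere η] with σ hσ
      simp only [cpow_eq_exp (abs_pos.2 hσ)]
      have := differentiable_deg n
      exact DifferentiableOn.mul (Differentiable.differentiableOn (by fun_prop))
        ((hd σ).mono fun μ hm => hm.1.1)

/-- Where the integral converges, the pairing of the homogeneous extension with a function `ψ` is
holomorphic in the degree of homogeneity and in the function on the sphere at once. -/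
lemma analyticAt_integral_homExt {n : ℕ} {k : ℂ → S n → ℂ} {μ₀ : ℂ}
    (hk : IsHolomorphicFamilyAt k μ₀) {ψ : E n → ℂ} (hψ : AEStronglyMeasurable ψ volume)
    (hi : ∀ᶠ s in nhds (deg n μ₀).re, Integrable (fun x : E n => ‖x‖ ^ s * ‖ψ x‖)) :
    AnalyticAt ℂ (fun μ => ∫ x, homExt μ (k μ) x * ψ x) μ₀ := by
  obtain ⟨U, hU, hμ, hck, ⟨B, hB⟩, hd⟩ := hk
  obtain ⟨ε, hε, hεi⟩ := Metric.eventually_nhds_iff.1 hi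
  set d := (deg n μ₀).re
  let W := (fun μ : ℂ => (deg n μ).re) ⁻¹' Ioo (d - ε / 2) (d + ε / 2)
  have hW : IsOpen W := isOpen_Ioo.preimage (continuous_deg_re n)
  have hg : Integrable (fun x : E n => B * (‖x‖ ^ (d - ε / 2) * ‖ψ x‖ + ‖x‖ ^ (d + ε / 2) * ‖ψ x‖)) := by
    refine ((hεi ?_).add (hεi ?_)).const_mul B <;>
    · rw [Real.dist_eq, abs_lt]
      constructor <;> linarith
  have h := differentiableOn_integral_of_dominated (ν := volume) (hU.inter hW)
    (F := fun μ x => homExt μ (k μ) x * ψ x)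
    (fun μ hm => (aestronglyMeasurable_homExt μ (hck μ hm.1)).mul hψ) ?_ hg ?_
  · refine h.analyticAt ((hU.inter hW).mem_nhds ⟨hμ, ?_⟩)
    constructor <;> simp only [d] <;> linarith
  · filter_upwards [Measure.ae_ne volume (0 : E n)] with x hx
    simp only [homExt_of_ne _ _ hx, cpow_eq_exp (norm_pos_iff.2 hx)]
    have := differentiable_deg n
    exact ((Differentiable.differentiableOn (by fun_prop)).mul
      ((hd _).mono inter_subset_left)).mul_const _
  · filter_upwards [Measure.ae_ne volume (0 : E n)] with x hx μ hm
    have hx' : 0 < ‖x‖ := norm_pos_iff.2 hx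
    have hB0 : 0 ≤ B := (norm_nonneg _).trans (hB μ hm.1 (dir x hx))
    rw [norm_mul, ← add_mul, ← mul_assoc]
    refine mul_le_mul_of_nonneg_right ((norm_homExt_le (hB μ hm.1) hx).trans ?_) (norm_nonneg _)
    refine mul_le_mul_of_nonneg_left ?_ hB0
    have p0 := Real.rpow_pos_of_pos hx' (d - ε / 2)
    have p1 := Real.rpow_pos_of_pos hx' (d + ε / 2)
    rcases le_total ‖x‖ 1 with h | h
    · have := Real.rpow_le_rpow_of_exponent_ge hx' h hm.2.1.le
      linarith
    · have := Real.rpow_le_rpow_of_exponent_le h hm.2.2.le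
      linarith

/-! ### Poles of the Gamma factors -/

/-- The identity theorem on the complement of a countable set. -/
lemma eq_of_eventuallyEq_of_countable {A : Set ℂ} (hA : A.Countable) {f g : ℂ → ℂ}
    (hf : ∀ z ∉ A, AnalyticAt ℂ f z) (hg : ∀ z ∉ A, AnalyticAt ℂ g z) {z₀ : ℂ} (h0 : z₀ ∉ A)
    (h : f =ᶠ[𝓝 z₀] g) {z : ℂ} (hz : z ∉ A) : f z = g z :=
  AnalyticOnNhd.eqOn_of_preconnected_of_eventuallyEq (U := Aᶜ) hf hg
    (hA.isConnected_compl_of_one_lt_rank (by simp)).isPreconnected h0 h hz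

lemma polesQ_countable (n : ℕ) : (polesQ n).Countable := by
  refine (countable_range (fun j : ℕ => 1 + 2 * (j : ℂ) - ((n + 1 : ℕ) : ℂ) / 2)).mono ?_
  rintro μ ⟨j, rfl⟩
  exact ⟨j, rfl⟩

lemma polesV_countable (n : ℕ) : (polesV n).Countable := by
  refine (countable_range (fun j : ℕ => ((n + 1 : ℕ) : ℂ) / 2 + 2 * (j : ℂ))).mono ?_
  rintro μ ⟨j, rfl⟩
  exact ⟨j, rfl⟩

lemma analyticAt_Gamma {z : ℂ} (hz : ∀ j : ℕ, z ≠ -j) : AnalyticAt ℂ Complex.Gamma z := by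
  have h : (Complex.Gamma z)⁻¹ ≠ 0 := inv_ne_zero (Complex.Gamma_ne_zero hz)
  have h1 : AnalyticAt ℂ (fun s => (Complex.Gamma s)⁻¹) z :=
    Complex.differentiable_one_div_Gamma.analyticAt z
  exact (h1.inv h).congr (.of_forall fun s => by simp)

/-- The poles of the Gamma function are simple. -/
lemma exists_eq_div_Gamma (j : ℕ) : ∃ g : ℂ → ℂ, AnalyticAt ℂ g (-(j : ℂ)) ∧
    ∀ᶠ s in 𝓝[≠] (-(j : ℂ)), Complex.Gamma s = g s / (s + j) := by
  induction j with
  | zero =>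
    refine ⟨fun s => Complex.Gamma (s + 1), ?_, ?_⟩
    · refine AnalyticAt.comp (f := fun s : ℂ => s + 1) (analyticAt_Gamma fun j h => ?_) (by fun_prop)
      have h1 : ((j + 1 : ℕ) : ℂ) = 0 := by push_cast; linear_combination h
      exact j.succ_ne_zero (by exact_mod_cast h1)
    · filter_upwards [self_mem_nhdsWithin] with s hs
      have hs' : s ≠ 0 := by simpa using hs
      rw [Complex.Gamma_add_one s hs']
      simp [hs']
  | succ j ih =>
    obtain ⟨g, hg, he⟩ := ih
    have h0 : -((j + 1 : ℕ) : ℂ) ≠ 0 := neg_ne_zero.2 (by exact_mod_cast j.succ_ne_zero)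
    have hsh : -((j + 1 : ℕ) : ℂ) + 1 = -(j : ℂ) := by push_cast; ring
    refine ⟨fun s => g (s + 1) / s, ?_, ?_⟩
    · refine AnalyticAt.div ?_ analyticAt_id h0
      exact AnalyticAt.comp (f := fun s : ℂ => s + 1) (by rwa [hsh]) (by fun_prop)
    · have ht : Tendsto (fun s : ℂ => s + 1) (𝓝[≠] (-((j + 1 : ℕ) : ℂ))) (𝓝[≠] (-(j : ℂ))) := by
        refine tendsto_nhdsWithin_iff.2 ⟨?_, ?_⟩
        · rw [← hsh]
          exact ((continuous_add_const 1).tendsto _).mono_left nhdsWithin_le_nhds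
        · filter_upwards [self_mem_nhdsWithin] with s hs h
          exact hs (by rw [mem_singleton_iff] at h ⊢; rw [← hsh] at h; exact add_right_cancel h)
      filter_upwards [ht.eventually he, (eventually_ne_nhds h0).filter_mono nhdsWithin_le_nhds]
        with s h1 h2
      rw [Complex.Gamma_add_one s h2] at h1
      rw [div_right_comm, eq_div_iff h2, mul_comm, h1]
      push_cast
      ring

/-- Near a point where `c - z / 2` is a pole of the Gamma function, this pole is simple. -/
lemma exists_eq_div_Gamma_comp {c z₀ : ℂ} {j : ℕ} (h : c - z₀ / 2 = -(j : ℂ)) :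
    ∃ g : ℂ → ℂ, AnalyticAt ℂ g z₀ ∧
      ∀ᶠ z in 𝓝[≠] z₀, Complex.Gamma (c - z / 2) = g z / (z - z₀) := by
  obtain ⟨g, hg, he⟩ := exists_eq_div_Gamma j
  refine ⟨fun z => -2 * g (c - z / 2), ?_, ?_⟩
  · refine analyticAt_const.mul (AnalyticAt.comp (f := fun z : ℂ => c - z / 2) (by rwa [h]) ?_)
    fun_prop
  · have ht : Tendsto (fun z : ℂ => c - z / 2) (𝓝[≠] z₀) (𝓝[≠] (-(j : ℂ))) := by
      refine tendsto_nhdsWithin_iff.2 ⟨?_, ?_⟩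
      · rw [← h]
        exact Tendsto.mono_left (Continuous.tendsto (by fun_prop) z₀) nhdsWithin_le_nhds
      · filter_upwards [self_mem_nhdsWithin] with z hz h1
        rw [mem_singleton_iff, ← h] at h1
        exact hz (by rw [mem_singleton_iff]; linear_combination -2 * h1)
    filter_upwards [ht.eventually he, self_mem_nhdsWithin] with z h1 h2
    have h3 : z - z₀ ≠ 0 := sub_ne_zero.2 h2
    have h4 : c - z / 2 + j = -(z - z₀) / 2 := by linear_combination h
    rw [h1, h4]
    field_simp

lemma simple_pole {F g : ℂ → ℂ} {z₀ : ℂ} (hg : AnalyticAt ℂ g z₀)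
    (h : ∀ᶠ z in 𝓝[≠] z₀, F z = g z / (z - z₀)) :
    MeromorphicAt F z₀ ∧ -1 ≤ meromorphicOrderAt F z₀ := by
  have hi : MeromorphicAt (fun z : ℂ => z - z₀) z₀ := by fun_prop
  have h1 : F =ᶠ[𝓝[≠] z₀] g * (fun z => z - z₀)⁻¹ := by
    filter_upwards [h] with z hz
    simp [hz, div_eq_mul_inv]
  refine ⟨(hg.meromorphicAt.mul hi.inv).congr h1.symm, ?_⟩
  rw [meromorphicOrderAt_congr h1, meromorphicOrderAt_mul hg.meromorphicAt hi.inv,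
    meromorphicOrderAt_inv]
  have h2 : meromorphicOrderAt (fun z : ℂ => z - z₀) z₀ = 1 := by
    simp
  rw [h2]
  have h3 := hg.meromorphicOrderAt_nonneg
  calc (-1 : WithTop ℤ) = 0 + -1 := by simp
    _ ≤ _ := add_le_add_left h3 _

/-- The entire factor of `C_N`: the pole-free power of `π` and the reciprocal Gamma function, the
other Gamma function being left out. -/
noncomputable def Creg (n : ℕ) (μ : ℂ) : ℂ :=
  2 * (Real.pi : ℂ) ^ (μ + (((n + 1 : ℕ) : ℂ) - 1) / 2) *
    (Complex.Gamma ((((n + 1 : ℕ) : ℂ) + 2 * μ) / 4))⁻¹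

lemma differentiable_Creg (n : ℕ) : Differentiable ℂ (Creg n) := by
  have h1 : Differentiable ℂ (fun μ : ℂ => (Real.pi : ℂ) ^ (μ + (((n + 1 : ℕ) : ℂ) - 1) / 2)) := by
    simp only [cpow_eq_exp Real.pi_pos]
    fun_prop
  have h2 : Differentiable ℂ (fun μ : ℂ => (Complex.Gamma ((((n + 1 : ℕ) : ℂ) + 2 * μ) / 4))⁻¹) :=
    Complex.differentiable_one_div_Gamma.comp (g := fun s => (Complex.Gamma s)⁻¹)
      (f := fun μ : ℂ => (((n + 1 : ℕ) : ℂ) + 2 * μ) / 4) (by fun_prop)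
  exact (h1.const_mul 2).mul h2

lemma C_eq_Creg (n : ℕ) (μ : ℂ) :
    C n μ = Creg n μ * Complex.Gamma ((2 - ((n + 1 : ℕ) : ℂ)) / 4 - μ / 2) := by
  rw [C, Creg, show (2 - ((n + 1 : ℕ) : ℂ) - 2 * μ) / 4 = (2 - ((n + 1 : ℕ) : ℂ)) / 4 - μ / 2 by ring]
  ring

/-- The entire factor of `(C_N(-ν))⁻¹`; the factor left out is the Gamma function in the denominator
of `C_N(-ν)`. -/
noncomputable def Dreg (n : ℕ) (ν : ℂ) : ℂ :=
  (2 * (Real.pi : ℂ) ^ (-ν + (((n + 1 : ℕ) : ℂ) - 1) / 2))⁻¹ *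
    (Complex.Gamma ((2 - ((n + 1 : ℕ) : ℂ) + 2 * ν) / 4))⁻¹

lemma differentiable_Dreg (n : ℕ) : Differentiable ℂ (Dreg n) := by
  have h1 : Differentiable ℂ
      (fun ν : ℂ => (2 * (Real.pi : ℂ) ^ (-ν + (((n + 1 : ℕ) : ℂ) - 1) / 2))⁻¹) := by
    simp only [cpow_eq_exp Real.pi_pos, mul_inv, ← Complex.exp_neg]
    fun_prop
  have h2 : Differentiable ℂ
      (fun ν : ℂ => (Complex.Gamma ((2 - ((n + 1 : ℕ) : ℂ) + 2 * ν) / 4))⁻¹) :=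
    Complex.differentiable_one_div_Gamma.comp (g := fun s => (Complex.Gamma s)⁻¹)
      (f := fun ν : ℂ => (2 - ((n + 1 : ℕ) : ℂ) + 2 * ν) / 4) (by fun_prop)
  exact h1.mul h2

lemma C_neg_inv (n : ℕ) (ν : ℂ) :
    (C n (-ν))⁻¹ = Dreg n ν * Complex.Gamma (((n + 1 : ℕ) : ℂ) / 4 - ν / 2) := by
  rw [C, Dreg, show (((n + 1 : ℕ) : ℂ) + 2 * -ν) / 4 = ((n + 1 : ℕ) : ℂ) / 4 - ν / 2 by ring,
    show 2 - ((n + 1 : ℕ) : ℂ) - 2 * -ν = 2 - ((n + 1 : ℕ) : ℂ) + 2 * ν by ring, inv_div,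
    div_eq_mul_inv, mul_inv]
  ring

lemma arg_ne_of_notMem_polesQ {n : ℕ} {μ : ℂ} (hμ : μ ∉ polesQ n) (j : ℕ) :
    (2 - ((n + 1 : ℕ) : ℂ)) / 4 - μ / 2 ≠ -j := fun h =>
  hμ ⟨j, by linear_combination -2 * h⟩

lemma arg_ne_of_notMem_polesV {n : ℕ} {ν : ℂ} (hν : ν ∉ polesV n) (j : ℕ) :
    ((n + 1 : ℕ) : ℂ) / 4 - ν / 2 ≠ -j := fun h =>
  hν ⟨j, by linear_combination -2 * h⟩

lemma analyticAt_C {n : ℕ} {μ : ℂ} (hμ : μ ∉ polesQ n) : AnalyticAt ℂ (C n) μ := by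
  have h1 : AnalyticAt ℂ
      (fun μ : ℂ => Complex.Gamma ((2 - ((n + 1 : ℕ) : ℂ)) / 4 - μ / 2)) μ :=
    AnalyticAt.comp (f := fun μ : ℂ => (2 - ((n + 1 : ℕ) : ℂ)) / 4 - μ / 2)
      (analyticAt_Gamma (arg_ne_of_notMem_polesQ hμ)) (by fun_prop)
  rw [show C n = _ from funext (C_eq_Creg n)]
  exact ((differentiable_Creg n).analyticAt μ).mul h1

lemma analyticAt_C_neg_inv {n : ℕ} {ν : ℂ} (hν : ν ∉ polesV n) :
    AnalyticAt ℂ (fun ν => (C n (-ν))⁻¹) ν := by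
  have h1 : AnalyticAt ℂ (fun ν : ℂ => Complex.Gamma (((n + 1 : ℕ) : ℂ) / 4 - ν / 2)) ν :=
    AnalyticAt.comp (f := fun ν : ℂ => ((n + 1 : ℕ) : ℂ) / 4 - ν / 2)
      (analyticAt_Gamma (arg_ne_of_notMem_polesV hν)) (by fun_prop)
  simp only [C_neg_inv]
  exact ((differentiable_Dreg n).analyticAt ν).mul h1

lemma C_ne_zero {n : ℕ} {μ : ℂ} (hμ : μ ∉ polesQ n) (hμ' : -μ ∉ polesV n) : C n μ ≠ 0 := by
  have h1 := Complex.Gamma_ne_zero (arg_ne_of_notMem_polesQ hμ)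
  have h2 := Complex.Gamma_ne_zero (arg_ne_of_notMem_polesV hμ')
  rw [show ((n + 1 : ℕ) : ℂ) / 4 - -μ / 2 = (((n + 1 : ℕ) : ℂ) + 2 * μ) / 4 by ring] at h2
  have hpi : (Real.pi : ℂ) ≠ 0 := Complex.ofReal_ne_zero.2 Real.pi_ne_zero
  rw [C_eq_Creg, Creg]
  exact mul_ne_zero (mul_ne_zero (mul_ne_zero two_ne_zero (by simp [Complex.cpow_eq_zero_iff, hpi]))
    (inv_ne_zero h2)) h1

lemma notMem_polesQ_of_lt {n : ℕ} {μ : ℂ} (h : -1 < (deg n μ).re) : μ ∉ polesQ n := by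
  rintro ⟨j, rfl⟩
  rw [deg_re] at h
  simp at h
  have : (0 : ℝ) ≤ j := j.cast_nonneg
  linarith

lemma notMem_polesV_of_lt {n : ℕ} {ν : ℂ} (h : ν.re < ((n + 1 : ℕ) : ℝ) / 2) : ν ∉ polesV n := by
  rintro ⟨j, rfl⟩
  simp at h
  have : (0 : ℝ) ≤ j := j.cast_nonneg
  linarith

/-! ### The meromorphic continuation of the kernel operators -/

/-- The Mellin transforms of a Schwartz function on the two rays of the line spanned by `η`,
added up. -/
noncomputable def lineMellin {n : ℕ} (ψ : 𝓢(E n, ℂ)) (a : ℂ) (η : S n) : ℂ :=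
  mellin (fun r => ψ (r • (η : E n))) a + mellin (fun r => ψ (r • ((-η : S n) : E n))) a

lemma lineMellin_add {n : ℕ} (ψ χ : 𝓢(E n, ℂ)) {a : ℂ} (ha : 0 < a.re) (η : S n) :
    lineMellin (ψ + χ) a η = lineMellin ψ a η + lineMellin χ a η := by
  have h (ξ : S n) := (hasMellin_add (mellinConvergent_ray ψ ξ ha) (mellinConvergent_ray χ ξ ha)).2
  simp only [lineMellin, add_apply, h]
  ring

lemma lineMellin_smul {n : ℕ} (c : ℂ) (ψ : 𝓢(E n, ℂ)) (a : ℂ) (η : S n) :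
    lineMellin (c • ψ) a η = c * lineMellin ψ a η := by
  simp only [lineMellin, smul_apply, mellin_const_smul]
  rw [smul_eq_mul, smul_eq_mul, mul_add]

lemma lineMellin_neg {n : ℕ} (ψ : 𝓢(E n, ℂ)) (a : ℂ) (η : S n) :
    lineMellin ψ a (-η) = lineMellin ψ a η := by
  rw [lineMellin, lineMellin, neg_neg, add_comm]

lemma contMDiff_lineMellin {n : ℕ} (ψ : 𝓢(E n, ℂ)) {a : ℂ} (ha : 0 < a.re) :
    ContMDiff (𝓡 n) 𝓘(ℝ, ℂ) ∞ (lineMellin ψ a) :=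
  (contMDiff_mellin_ray ψ ha).add
    ((contMDiff_mellin_ray ψ ha).comp contMDiff_neg_sphere)

lemma isHolomorphicFamilyAt_lineMellin {n : ℕ} (ψ : 𝓢(E n, ℂ)) {μ₀ : ℂ}
    (h0 : (deg n μ₀).re < 0) :
    IsHolomorphicFamilyAt (fun μ => lineMellin ψ (-deg n μ)) μ₀ :=
  (isHolomorphicFamilyAt_mellin_ray ψ h0).add (isHolomorphicFamilyAt_mellin_ray ψ h0).comp_neg_sphere

/-- The kernel integral in terms of the Fourier transform of a test function. -/
lemma half_C_mul_lineMellin {n : ℕ} {μ : ℂ} (h0 : (deg n μ).re < 0) (h1 : -1 < (deg n μ).re)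
    (μ₁ : ℂ) (h : smooth n) (η : S n) :
    C n μ / 2 * lineMellin (𝓕 (testFun (-μ₁ - 1) h)) (-deg n μ) η =
      moment (μ₁ - μ) * kernelIntegral n μ h.1 η := by
  rw [lineMellin, ← integral_kernel_eq_mellin _ η h0 h1, integral_kernel_testFun, deg_add_deg]

lemma notMem_polesV_of_neg {n : ℕ} {μ : ℂ} (h0 : (deg n μ).re < 0) : -μ ∉ polesV n := by
  refine notMem_polesV_of_lt ?_
  rw [deg_re] at h0
  rw [Complex.neg_re]
  linarith

/-- An interior point of the strip where the kernel integral and the formula in terms of the Fourier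
transform both converge. -/
lemma exists_eventually_strip (n : ℕ) :
    ∃ μ₀, ∀ᶠ μ in 𝓝 μ₀, -1 < (deg n μ).re ∧ (deg n μ).re < 0 := by
  let μ₀ : ℂ := 1 / 2 - ((n + 1 : ℕ) : ℂ) / 2
  have hd : (deg n μ₀).re = -1 / 2 := by
    have : deg n μ₀ = ((-1 / 2 : ℝ) : ℂ) := by
      simp only [deg, μ₀]
      push_cast
      ring
    rw [this, Complex.ofReal_re]
  have h := (continuous_deg_re n).tendsto μ₀
  exact ⟨μ₀, (h.eventually_const_lt (by rw [hd]; norm_num)).and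
    (h.eventually_lt_const (by rw [hd]; norm_num))⟩

/-- The quotient `lineMellin / moment` does not depend on the test function. In the strip it is a
multiple of the kernel integral, and the identity continues to `Re μ > -N/2`. -/
lemma moment_mul_lineMellin {n : ℕ} {μ : ℂ} (h0 : (deg n μ).re < 0) (μ₁ μ₂ : ℂ) (h : smooth n)
    (η : S n) :
    moment (μ₂ - μ) * lineMellin (𝓕 (testFun (-μ₁ - 1) h)) (-deg n μ) η =
      moment (μ₁ - μ) * lineMellin (𝓕 (testFun (-μ₂ - 1) h)) (-deg n μ) η := by
  let U : Set ℂ := {μ | (deg n μ).re < 0}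
  have hana (μ₁ μ₂ : ℂ) : AnalyticOnNhd ℂ (fun μ => moment (μ₂ - μ) *
      lineMellin (𝓕 (testFun (-μ₁ - 1) h)) (-deg n μ) η) U := fun μ hμ =>
    ((moment_differentiable.comp (f := fun μ => μ₂ - μ) (by fun_prop)).analyticAt μ).mul
      ((isHolomorphicFamilyAt_lineMellin _ hμ).analyticAt η)
  have hconn : IsPreconnected U := by
    have hU : U = {μ : ℂ | -(((n + 1 : ℕ) : ℝ) / 2) < μ.re} := by
      ext μ
      simp only [U, mem_ofPred_eq, deg_re]
      constructor <;> intro h <;> linarith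
    rw [hU]
    exact (convex_halfSpace_re_gt _).isPreconnected
  obtain ⟨μ₀, hμ₀⟩ := exists_eventually_strip n
  refine (hana μ₁ μ₂).eqOn_of_preconnected_of_eventuallyEq (hana μ₂ μ₁) hconn (z₀ := μ₀) ?_ ?_ h0
  · exact hμ₀.self_of_nhds.2
  · filter_upwards [hμ₀] with μ hμ
    have hC : C n μ / 2 ≠ 0 :=
      div_ne_zero (C_ne_zero (notMem_polesQ_of_lt hμ.1) (notMem_polesV_of_neg hμ.2)) two_ne_zero
    refine mul_left_cancel₀ hC ?_
    rw [mul_left_comm, half_C_mul_lineMellin hμ.2 hμ.1, mul_left_comm (C n μ / 2),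
      half_C_mul_lineMellin hμ.2 hμ.1, mul_left_comm]

/-- The operator with kernel `|⟨σ, η⟩| ^ (-μ - N/2)` where the integral converges. -/
noncomputable def kernelOp {n : ℕ} {μ : ℂ} (hμ : -1 < (deg n μ).re) :
    smooth n →ₗ[ℂ] smoothEven n where
  toFun h := ⟨⟨kernelIntegral n μ h.1, kernelIntegral_contMDiff hμ h⟩, fun η => by
    simp [kernelIntegral]⟩
  map_add' h k := by
    ext η
    have := integral_add (integrable_kernel hμ (smooth_continuous h) η)
      (integrable_kernel hμ (smooth_continuous k) η)
    simpa [kernelIntegral, mul_add] using this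
  map_smul' c h := by
    ext η
    simp [kernelIntegral, mul_left_comm _ c, integral_const_mul]

/-- The operator for `Re μ > -N/2`: the formula `half_C_mul_lineMellin` with `μ₁ = μ`, solved for
the kernel integral. At the points of `polesQ n` the value is junk, inherited from that of `C n μ`. -/
noncomputable def mellinOp {n : ℕ} {μ : ℂ} (hμ : (deg n μ).re < 0) :
    smooth n →ₗ[ℂ] smoothEven n where
  toFun h := ⟨(C n μ / 2 * (moment 0)⁻¹) •
      (⟨lineMellin (𝓕 (testFun (-μ - 1) h)) (-deg n μ),
        contMDiff_lineMellin _ (by simpa using hμ)⟩ : smooth n), fun η => by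
    simp [lineMellin_neg]⟩
  map_add' h k := by
    ext η
    simp [testFun_add, FourierTransform.fourier_add,
      lineMellin_add _ _ (a := -deg n μ) (by simpa using hμ), mul_add]
  map_smul' c h := by
    ext η
    simp [testFun_smul, FourierTransform.fourier_smul, lineMellin_smul, mul_left_comm _ c]

open Classical in
/-- The meromorphic continuation of the operators with kernel `|⟨σ, η⟩| ^ (-μ - N/2)`. -/
noncomputable def kernelFamily (n : ℕ) (μ : ℂ) : smooth n →ₗ[ℂ] smoothEven n :=
  if hμ : -1 < (deg n μ).re then kernelOp hμ
  else mellinOp (μ := μ) (by linarith)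

lemma kernelFamily_of_lt {n : ℕ} {μ : ℂ} (hμ : -1 < (deg n μ).re) (h : smooth n) :
    (kernelFamily n μ h).1.1 = kernelIntegral n μ h.1 := by
  rw [kernelFamily, dif_pos hμ]
  rfl

lemma kernelFamily_of_neg {n : ℕ} {μ : ℂ} (hμ : (deg n μ).re < 0) (h : smooth n) (η : S n) :
    (kernelFamily n μ h).1.1 η = C n μ / 2 * (moment 0)⁻¹ *
      lineMellin (𝓕 (testFun (-μ - 1) h)) (-deg n μ) η := by
  by_cases h1 : -1 < (deg n μ).re
  · rw [kernelFamily_of_lt h1, mul_right_comm, half_C_mul_lineMellin hμ h1, sub_self]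
    field_simp [moment_zero_ne_zero]
  · rw [kernelFamily, dif_neg h1]
    rfl

/-- Near `μ₀` the test function can be chosen independently of `μ`. -/
lemma eventually_kernelFamily_eq {n : ℕ} {μ₀ : ℂ} (h0 : (deg n μ₀).re < 0) (h : smooth n) :
    ∀ᶠ μ in 𝓝 μ₀, (kernelFamily n μ h).1.1 = fun η => C n μ * ((2 * moment (μ₀ - μ))⁻¹ *
      lineMellin (𝓕 (testFun (-μ₀ - 1) h)) (-deg n μ) η) := by
  have h1 : ∀ᶠ μ in 𝓝 μ₀, moment (μ₀ - μ) ≠ 0 :=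
    ContinuousAt.eventually_ne
      (moment_differentiable.continuous.comp (continuous_const.sub continuous_id)).continuousAt
      (by simpa using moment_zero_ne_zero)
  filter_upwards [h1, ((continuous_deg_re n).tendsto μ₀).eventually_lt_const h0] with μ hm hd
  funext η
  have h2 := moment_mul_lineMellin hd μ μ₀ h η
  rw [sub_self] at h2
  rw [kernelFamily_of_neg hd]
  have h3 := moment_zero_ne_zero
  field_simp
  rw [mul_assoc, mul_comm (lineMellin _ _ _), h2, mul_assoc]

lemma analyticAt_inv_moment (μ₀ : ℂ) : AnalyticAt ℂ (fun μ => (2 * moment (μ₀ - μ))⁻¹) μ₀ := by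
  have h1 : Differentiable ℂ (fun μ => 2 * moment (μ₀ - μ)) :=
    (moment_differentiable.comp (f := fun μ => μ₀ - μ) (by fun_prop)).const_mul 2
  exact (h1.analyticAt μ₀).inv (by simpa using moment_zero_ne_zero)

lemma isHolomorphicFamilyAt_kernelFamily {n : ℕ} {μ₀ : ℂ} (hμ : μ₀ ∉ polesQ n) (h : smooth n) :
    IsHolomorphicFamilyAt (fun μ => (kernelFamily n μ h).1.1) μ₀ := by
  by_cases h1 : -1 < (deg n μ₀).re
  · have h2 := ((continuous_deg_re n).tendsto μ₀).eventually_const_lt h1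
    refine (isHolomorphicFamilyAt_kernelIntegral (.const (smooth_continuous h)) h1 ?_).congr
      (h2.mono fun μ hm => kernelFamily_of_lt hm h)
    exact h2.mono fun μ hm => (kernelIntegral_contMDiff hm h).continuous
  · have h0 : (deg n μ₀).re < 0 := by linarith
    exact (((isHolomorphicFamilyAt_lineMellin _ h0).mul_analytic
      (analyticAt_inv_moment μ₀)).mul_analytic (analyticAt_C hμ)).congr
        (eventually_kernelFamily_eq h0 h)

lemma deg_re_of_mem_polesQ {n : ℕ} {μ : ℂ} (hμ : μ ∈ polesQ n) : (deg n μ).re < 0 := by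
  by_contra h0
  exact notMem_polesQ_of_lt (by linarith) hμ

theorem isKernelFamily_kernelFamily (n : ℕ) : IsKernelFamily n (kernelFamily n) := by
  have hlt : ∀ μ : ℂ, μ.re < 1 - ((n + 1 : ℕ) : ℝ) / 2 → -1 < (deg n μ).re := fun μ hμ => by
    rw [deg_re]
    linarith
  refine ⟨fun μ hμ h η => integrable_kernel (hlt μ hμ) (smooth_continuous h) η,
    fun μ hμ h η => congrFun (kernelFamily_of_lt (hlt μ hμ) h) η, fun h η =>
    ⟨fun μ hμ => (isHolomorphicFamilyAt_kernelFamily hμ h).analyticAt η, fun μ₀ hμ => ?_⟩⟩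
  have h0 := deg_re_of_mem_polesQ hμ
  obtain ⟨j, hj⟩ := hμ
  obtain ⟨g, hg, he⟩ := exists_eq_div_Gamma_comp (c := (2 - ((n + 1 : ℕ) : ℂ)) / 4) (z₀ := μ₀)
    (j := j) (by rw [hj]; ring)
  refine simple_pole ((((differentiable_Creg n).analyticAt μ₀).mul hg).mul
    ((analyticAt_inv_moment μ₀).mul
      ((isHolomorphicFamilyAt_lineMellin (𝓕 (testFun (-μ₀ - 1) h)) h0).analyticAt η))) ?_
  filter_upwards [he, (eventually_kernelFamily_eq h0 h).filter_mono nhdsWithin_le_nhds]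
    with μ h1 h2
  simp only [h2, C_eq_Creg, h1, Pi.mul_apply]
  ring

/-! ### Homogeneous distributions -/

lemma homExt_add {n : ℕ} (ν : ℂ) (h k : S n → ℂ) (x : E n) :
    homExt ν (h + k) x = homExt ν h x + homExt ν k x := by
  by_cases hx : x = 0 <;> simp [homExt, hx, mul_add]

lemma homExt_const_smul {n : ℕ} (ν c : ℂ) (h : S n → ℂ) (x : E n) :
    homExt ν (c • h) x = c * homExt ν h x := by
  by_cases hx : x = 0 <;> simp [homExt, hx, mul_left_comm]

/-- Continuity of the pairing in the Schwartz topology. -/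
lemma exists_integral_homExt_bound {n : ℕ} {ν : ℂ} (hν : -((n + 1 : ℕ) : ℝ) < (deg n ν).re)
    {h : S n → ℂ} (hh : Continuous h) : ∃ (s : Finset (ℕ × ℕ)) (K : ℝ), 0 ≤ K ∧
      ∀ φ : 𝓢(E n, ℂ), ‖∫ x, homExt ν h x * φ x‖ ≤ K * s.sup (schwartzSeminormFamily ℂ (E n) ℂ) φ := by
  obtain ⟨k, hk⟩ := exists_nat_gt ((deg n ν).re + (n + 1 : ℕ))
  obtain ⟨B, hB0, hB⟩ := exists_bound hh
  refine ⟨Finset.Iic (k, 0), B * 2 ^ k * ∫ x : E n, ‖x‖ ^ (deg n ν).re * ((1 + ‖x‖) ^ k)⁻¹,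
    mul_nonneg (by positivity) (integral_nonneg fun x => by positivity), fun φ => ?_⟩
  rw [mul_right_comm, ← integral_const_mul]
  refine norm_integral_le_of_norm_le ((integrable_norm_rpow_mul_weight hν hk).const_mul _) ?_
  filter_upwards [Measure.ae_ne volume (0 : E n)] with x hx
  have h1 := SchwartzMap.one_add_le_sup_seminorm_apply (𝕜 := ℂ) (m := (k, 0)) (k := k) (n := 0)
    le_rfl le_rfl φ x
  rw [norm_iteratedFDeriv_zero, ← le_div_iff₀' (by positivity), div_eq_mul_inv] at h1
  rw [norm_mul]
  calc ‖homExt ν h x‖ * ‖φ x‖ ≤ (B * ‖x‖ ^ (deg n ν).re) * (2 ^ k *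
        (Finset.Iic (k, 0)).sup (fun m => SchwartzMap.seminorm ℂ m.1 m.2) φ *
          ((1 + ‖x‖) ^ k)⁻¹) := by
        refine mul_le_mul (norm_homExt_le hB hx) h1 (norm_nonneg _) (by positivity)
    _ = _ := by
        unfold schwartzSeminormFamily
        ring

/-- Integration against the homogeneous extension of an even function, where the latter is locally
integrable, as a tempered distribution. -/
noncomputable def integralDist {n : ℕ} {ν : ℂ} (hν : -((n + 1 : ℕ) : ℝ) < (deg n ν).re) :
    smoothEven n →ₗ[ℂ] 𝓢'(E n, ℂ) where
  toFun h := ContinuousLinearMap.toPointwiseConvergenceCLM _ _ _ _ <|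
    SchwartzMap.mkCLMtoNormedSpace (σ := RingHom.id ℂ)
      (fun φ : 𝓢(E n, ℂ) => ∫ x, homExt ν h.1.1 x * φ x)
      (fun φ ψ => by
        have := integral_add (integrable_homExt_mul_schwartz hν (smooth_continuous h.1) φ)
          (integrable_homExt_mul_schwartz hν (smooth_continuous h.1) ψ)
        simpa [mul_add] using this)
      (fun c φ => by simp [mul_left_comm _ c, integral_const_mul])
      (exists_integral_homExt_bound hν (smooth_continuous h.1))
  map_add' h k := by
    ext φ
    have := integral_add (integrable_homExt_mul_schwartz hν (smooth_continuous h.1) φ)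
      (integrable_homExt_mul_schwartz hν (smooth_continuous k.1) φ)
    simp only [← add_mul, ← homExt_add] at this
    exact this
  map_smul' c h := by
    ext φ
    have := integral_const_mul (μ := volume) c (fun x => homExt ν h.1.1 x * φ x)
    simp only [← mul_assoc, ← homExt_const_smul] at this
    exact this

lemma lt_deg_re {n : ℕ} {ν : ℂ} (hν : ν.re < ((n + 1 : ℕ) : ℝ) / 2) :
    -((n + 1 : ℕ) : ℝ) < (deg n ν).re := by
  rw [deg_re]
  linarith

lemma lt_deg_neg_re {n : ℕ} {ν : ℂ} (hν : ((n + 1 : ℕ) : ℝ) / 2 - 1 < ν.re) :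
    -1 < (deg n (-ν)).re := by
  rw [deg_re, Complex.neg_re]
  linarith

lemma neg_card_lt {n : ℕ} {x : ℝ} (hx : -1 < x) : -((n + 1 : ℕ) : ℝ) < x := by
  have : (1 : ℝ) ≤ ((n + 1 : ℕ) : ℝ) := by exact_mod_cast n.succ_pos
  linarith

/-- The distribution for `Re ν > N/2 - 1`: the identity `(Q_μ h)^(μ) = C_N(μ) 𝓕 (h^(-μ))` with
`μ = -ν`, solved for `h^(ν)`. At the points of `polesV n` the value is junk, inherited from that of
`C n (-ν)`. -/
noncomputable def fourierDist {n : ℕ} {ν : ℂ} (hν : -1 < (deg n (-ν)).re) :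
    smoothEven n →ₗ[ℂ] 𝓢'(E n, ℂ) :=
  (C n (-ν))⁻¹ • (FourierTransform.fourierInvCLM ℂ 𝓢'(E n, ℂ)).toLinearMap ∘ₗ
    integralDist (neg_card_lt hν) ∘ₗ kernelOp hν ∘ₗ (smoothEven n).subtype

open Classical in
/-- The meromorphic continuation of the homogeneous distributions. -/
noncomputable def sphereDist (n : ℕ) (ν : ℂ) : smoothEven n →ₗ[ℂ] 𝓢'(E n, ℂ) :=
  if hν : ν.re < ((n + 1 : ℕ) : ℝ) / 2 then integralDist (lt_deg_re hν)
  else fourierDist (ν := ν) (lt_deg_neg_re (by linarith))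

lemma sphereDist_of_lt {n : ℕ} {ν : ℂ} (hν : ν.re < ((n + 1 : ℕ) : ℝ) / 2) (h : smoothEven n)
    (φ : 𝓢(E n, ℂ)) : sphereDist n ν h φ = ∫ x, homExt ν h.1.1 x * φ x := by
  rw [sphereDist, dif_pos hν]
  rfl

lemma sphereDist_of_gt {n : ℕ} {ν : ℂ} (hν : ((n + 1 : ℕ) : ℝ) / 2 - 1 < ν.re)
    (h : smoothEven n) (φ : 𝓢(E n, ℂ)) : sphereDist n ν h φ =
      (C n (-ν))⁻¹ * ∫ x, homExt (-ν) (kernelIntegral n (-ν) h.1.1) x * 𝓕⁻ φ x := by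
  by_cases h1 : ν.re < ((n + 1 : ℕ) : ℝ) / 2
  · have hd : (deg n (-ν)).re < 0 := by
      rw [deg_re, Complex.neg_re]
      linarith
    have hC := C_ne_zero (notMem_polesQ_of_lt (lt_deg_neg_re hν)) (notMem_polesV_of_neg hd)
    rw [sphereDist_of_lt h1, integral_homExt_kernelIntegral hd (lt_deg_neg_re hν)
      (smooth_continuous h.1) h.2, FourierTransform.fourier_fourierInv_eq, neg_neg,
      inv_mul_cancel_left₀ hC]
  · rw [sphereDist, dif_neg h1]
    rfl

lemma eventually_integrable_norm_rpow_mul {n : ℕ} (φ : 𝓢(E n, ℂ)) {s₀ : ℝ}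
    (hs : -((n + 1 : ℕ) : ℝ) < s₀) :
    ∀ᶠ s in 𝓝 s₀, Integrable (fun x : E n => ‖x‖ ^ s * ‖φ x‖) :=
  (eventually_gt_nhds hs).mono fun _ h => integrable_norm_rpow_mul φ h

lemma analyticAt_sphereDist_of_lt {n : ℕ} {ν₀ : ℂ} (hν : ν₀.re < ((n + 1 : ℕ) : ℝ) / 2)
    {k : ℂ → smoothEven n} (hk : IsHolomorphicFamilyAt (fun ν => (k ν).1.1) ν₀) (φ : 𝓢(E n, ℂ)) :
    AnalyticAt ℂ (fun ν => sphereDist n ν (k ν) φ) ν₀ := by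
  refine (analyticAt_integral_homExt hk φ.continuous.aestronglyMeasurable
    (eventually_integrable_norm_rpow_mul φ (lt_deg_re hν))).congr ?_
  filter_upwards [(Complex.continuous_re.tendsto ν₀).eventually_lt_const hν] with ν h
  exact (sphereDist_of_lt h _ φ).symm

/-- The factor by which `(C n (-ν))⁻¹` is multiplied in `sphereDist_of_gt` is holomorphic. -/
lemma analyticAt_integral_kernelIntegral {n : ℕ} {ν₀ : ℂ} (hν : ((n + 1 : ℕ) : ℝ) / 2 - 1 < ν₀.re)
    {k : ℂ → smoothEven n} (hk : IsHolomorphicFamilyAt (fun ν => (k ν).1.1) ν₀) (φ : 𝓢(E n, ℂ)) :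
    AnalyticAt ℂ (fun ν => ∫ x, homExt (-ν) (kernelIntegral n (-ν) (k ν).1.1) x * φ x) ν₀ := by
  have hd := lt_deg_neg_re hν
  have hk' : IsHolomorphicFamilyAt (fun μ => (k (-μ)).1.1) (-ν₀) :=
    IsHolomorphicFamilyAt.comp_neg (k := fun ν => (k ν).1.1) (by rwa [neg_neg])
  have h1 := isHolomorphicFamilyAt_kernelIntegral hk' hd
    ((((continuous_deg_re n).tendsto (-ν₀)).eventually_const_lt hd).mono fun μ hm =>
      (kernelIntegral_contMDiff hm (k (-μ)).1).continuous)
  have h2 := (analyticAt_integral_homExt h1 φ.continuous.aestronglyMeasurable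
    (eventually_integrable_norm_rpow_mul φ (neg_card_lt hd))).comp
      (f := fun ν : ℂ => -ν) analyticAt_id.neg
  simpa [Function.comp_def] using h2

lemma eventually_sphereDist_eq {n : ℕ} {ν₀ : ℂ} (hν : ((n + 1 : ℕ) : ℝ) / 2 - 1 < ν₀.re)
    (k : ℂ → smoothEven n) (φ : 𝓢(E n, ℂ)) :
    ∀ᶠ ν in 𝓝 ν₀, sphereDist n ν (k ν) φ =
      (C n (-ν))⁻¹ * ∫ x, homExt (-ν) (kernelIntegral n (-ν) (k ν).1.1) x * 𝓕⁻ φ x := by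
  filter_upwards [(Complex.continuous_re.tendsto ν₀).eventually_const_lt hν] with ν h
  exact sphereDist_of_gt h _ φ

lemma analyticAt_sphereDist {n : ℕ} {ν₀ : ℂ} (hν : ν₀ ∉ polesV n) {k : ℂ → smoothEven n}
    (hk : IsHolomorphicFamilyAt (fun ν => (k ν).1.1) ν₀) (φ : 𝓢(E n, ℂ)) :
    AnalyticAt ℂ (fun ν => sphereDist n ν (k ν) φ) ν₀ := by
  by_cases h1 : ν₀.re < ((n + 1 : ℕ) : ℝ) / 2
  · exact analyticAt_sphereDist_of_lt h1 hk φ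
  · have h2 : ((n + 1 : ℕ) : ℝ) / 2 - 1 < ν₀.re := by linarith
    exact ((analyticAt_C_neg_inv hν).mul (analyticAt_integral_kernelIntegral h2 hk (𝓕⁻ φ))).congr
      ((eventually_sphereDist_eq h2 k φ).mono fun ν h => h.symm)

/-- `sphereDist` as a family of maps on the spaces `V n ν`. -/
noncomputable def distFamily (n : ℕ) (ν : ℂ) : V n ν →ₗ[ℂ] 𝓢'(E n, ℂ) :=
  sphereDist n ν ∘ₗ (ext n ν).symm.toLinearMap

lemma distFamily_ext {n : ℕ} (ν : ℂ) (h : smoothEven n) :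
    distFamily n ν (ext n ν h) = sphereDist n ν h := by
  simp [distFamily]

theorem isDistributionFamily_distFamily (n : ℕ) : IsDistributionFamily n (distFamily n) := by
  refine ⟨fun ν hν f φ => ?_, fun ν hν f φ => ?_, fun h φ => ⟨fun ν hν => ?_, fun ν₀ hν => ?_⟩⟩
  · obtain ⟨h, rfl⟩ := (ext n ν).surjective f
    exact integrable_homExt_mul_schwartz (lt_deg_re hν) (smooth_continuous h.1) φ
  · obtain ⟨h, rfl⟩ := (ext n ν).surjective f
    rw [distFamily_ext, sphereDist_of_lt hν]
    rfl
  · simp only [distFamily_ext]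
    exact analyticAt_sphereDist hν (k := fun _ => h) (.const (smooth_continuous h.1)) φ
  · simp only [distFamily_ext]
    have h2 : ((n + 1 : ℕ) : ℝ) / 2 - 1 < ν₀.re := by
      by_contra h3
      exact notMem_polesV_of_lt (by linarith) hν
    obtain ⟨j, hj⟩ := hν
    obtain ⟨g, hg, he⟩ := exists_eq_div_Gamma_comp (c := ((n + 1 : ℕ) : ℂ) / 4) (z₀ := ν₀)
      (j := j) (by rw [hj]; ring)
    refine simple_pole ((((differentiable_Dreg n).analyticAt ν₀).mul hg).mul
      (analyticAt_integral_kernelIntegral h2 (k := fun _ => h)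
        (.const (smooth_continuous h.1)) (𝓕⁻ φ))) ?_
    filter_upwards [he, (eventually_sphereDist_eq h2 (fun _ => h) φ).filter_mono
      nhdsWithin_le_nhds] with ν h3 h4
    simp only [h4, C_neg_inv, h3, Pi.mul_apply]
    ring

/-! ### Uniqueness of the continuations and the identity between them -/

lemma IsKernelFamily.eq_kernelFamily {n : ℕ} {Q : ℂ → smooth n →ₗ[ℂ] smoothEven n}
    (hQ : IsKernelFamily n Q) {μ : ℂ} (hμ : μ ∉ polesQ n) (h : smooth n) :
    Q μ h = kernelFamily n μ h := by
  have hK := isKernelFamily_kernelFamily n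
  obtain ⟨μ₀, hμ₀⟩ := exists_eventually_strip n
  have hlt : ∀ μ, -1 < (deg n μ).re → μ.re < 1 - ((n + 1 : ℕ) : ℝ) / 2 := fun μ hm => by
    rw [deg_re] at hm
    linarith
  ext η
  refine eq_of_eventuallyEq_of_countable (polesQ_countable n) (hQ.meromorphic h η).1
    (hK.meromorphic h η).1 (notMem_polesQ_of_lt hμ₀.self_of_nhds.1) ?_ hμ
  filter_upwards [hμ₀] with μ hm
  rw [hQ.eq_integral μ (hlt μ hm.1), hK.eq_integral μ (hlt μ hm.1)]

lemma re_lt_of_strip {n : ℕ} {μ : ℂ} (h : -1 < (deg n μ).re) : μ.re < ((n + 1 : ℕ) : ℝ) / 2 := by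
  have h1 : (1 : ℝ) ≤ ((n + 1 : ℕ) : ℝ) := by exact_mod_cast n.succ_pos
  rw [deg_re] at h
  linarith

lemma neg_re_lt_of_strip {n : ℕ} {μ : ℂ} (h : (deg n μ).re < 0) :
    (-μ).re < ((n + 1 : ℕ) : ℝ) / 2 := by
  rw [deg_re] at h
  rw [Complex.neg_re]
  linarith

lemma IsDistributionFamily.eq_distFamily {n : ℕ} {ι : ∀ ν : ℂ, V n ν →ₗ[ℂ] 𝓢'(E n, ℂ)}
    (hι : IsDistributionFamily n ι) {ν : ℂ} (hν : ν ∉ polesV n) (h : smoothEven n) :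
    ι ν (ext n ν h) = sphereDist n ν h := by
  have hD := isDistributionFamily_distFamily n
  obtain ⟨μ₀, hμ₀⟩ := exists_eventually_strip n
  rw [← distFamily_ext]
  ext φ
  refine eq_of_eventuallyEq_of_countable (polesV_countable n) (hι.meromorphic h φ).1
    (hD.meromorphic h φ).1 (notMem_polesV_of_lt (re_lt_of_strip hμ₀.self_of_nhds.1)) ?_ hν
  filter_upwards [hμ₀] with μ hm
  rw [hι.eq_integral μ (re_lt_of_strip hm.1), hD.eq_integral μ (re_lt_of_strip hm.1)]

lemma analyticAt_C_mul_sphereDist {n : ℕ} {μ : ℂ} (hμ : μ ∉ polesQ n) (hμ' : -μ ∉ polesV n)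
    (h : smoothEven n) (φ : 𝓢(E n, ℂ)) :
    AnalyticAt ℂ (fun μ => C n μ * sphereDist n (-μ) h φ) μ :=
  (analyticAt_C hμ).mul ((analyticAt_sphereDist (k := fun _ => h) hμ'
    (.const (smooth_continuous h.1)) φ).comp analyticAt_id.neg)

lemma integral_homExt_kernelFamily_of_strip {n : ℕ} {μ : ℂ} (h1 : -1 < (deg n μ).re)
    (h0 : (deg n μ).re < 0) (h : smoothEven n) (φ : 𝓢(E n, ℂ)) :
    ∫ x, homExt μ (kernelFamily n μ h.1).1.1 x * φ x = C n μ * sphereDist n (-μ) h (𝓕 φ) := by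
  rw [kernelFamily_of_lt h1, sphereDist_of_lt (neg_re_lt_of_strip h0),
    integral_homExt_kernelIntegral h0 h1 (smooth_continuous h.1) h.2]

lemma countable_exceptional (n : ℕ) : (polesQ n ∪ Neg.neg ⁻¹' polesV n).Countable :=
  (polesQ_countable n).union ((polesV_countable n).preimage neg_injective)

/-- The identity of distributions on `ℝ^N ∖ {0}`: the left-hand side is holomorphic in `μ` also
where `(Q_μ h)^(μ)` is not locally integrable at the origin, since `φ` vanishes near it. -/
lemma integral_homExt_kernelFamily {n : ℕ} {μ : ℂ} (hμ : μ ∉ polesQ n) (hμ' : -μ ∉ polesV n)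
    (h : smoothEven n) {φ : 𝓢(E n, ℂ)} (hφ : (0 : E n) ∉ tsupport φ) :
    ∫ x, homExt μ (kernelFamily n μ h.1).1.1 x * φ x = C n μ * sphereDist n (-μ) h (𝓕 φ) := by
  obtain ⟨μ₀, hμ₀⟩ := exists_eventually_strip n
  have h0 := hμ₀.self_of_nhds
  refine eq_of_eventuallyEq_of_countable (A := polesQ n ∪ Neg.neg ⁻¹' polesV n) (z₀ := μ₀)
    (countable_exceptional n)
    (f := fun μ => ∫ x, homExt μ (kernelFamily n μ h.1).1.1 x * φ x)
    (g := fun μ => C n μ * sphereDist n (-μ) h (𝓕 φ)) (fun z hz => ?_) (fun z hz => ?_) ?_ ?_ ?_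
  · exact analyticAt_integral_homExt
      (isHolomorphicFamilyAt_kernelFamily (fun hz' => hz (Or.inl hz')) h.1)
      φ.continuous.aestronglyMeasurable
      (.of_forall fun s => integrable_norm_rpow_mul_of_notMem_tsupport φ hφ s)
  · exact analyticAt_C_mul_sphereDist (fun hz' => hz (Or.inl hz')) (fun hz' => hz (Or.inr hz')) h _
  · rintro (h1 | h1)
    exacts [notMem_polesQ_of_lt h0.1 h1, notMem_polesV_of_neg h0.2 h1]
  · filter_upwards [hμ₀] with μ hm
    exact integral_homExt_kernelFamily_of_strip hm.1 hm.2 h φ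
  · rintro (h1 | h1)
    exacts [hμ h1, hμ' h1]

/-- The identity of tempered distributions on `ℝ^N`. -/
lemma sphereDist_kernelFamily {n : ℕ} {μ : ℂ} (hμ : μ ∉ polesQ n) (hμ' : -μ ∉ polesV n)
    (hμ'' : μ ∉ polesV n) (h : smoothEven n) (φ : 𝓢(E n, ℂ)) :
    sphereDist n μ (kernelFamily n μ h.1) φ = C n μ * sphereDist n (-μ) h (𝓕 φ) := by
  obtain ⟨μ₀, hμ₀⟩ := exists_eventually_strip n
  have h0 := hμ₀.self_of_nhds
  refine eq_of_eventuallyEq_of_countable (A := (polesQ n ∪ Neg.neg ⁻¹' polesV n) ∪ polesV n)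
    (z₀ := μ₀) ((countable_exceptional n).union (polesV_countable n))
    (f := fun μ => sphereDist n μ (kernelFamily n μ h.1) φ)
    (g := fun μ => C n μ * sphereDist n (-μ) h (𝓕 φ)) (fun z hz => ?_) (fun z hz => ?_) ?_ ?_ ?_
  · exact analyticAt_sphereDist (fun hz' => hz (Or.inr hz'))
      (isHolomorphicFamilyAt_kernelFamily (fun hz' => hz (Or.inl (Or.inl hz'))) h.1) φ
  · exact analyticAt_C_mul_sphereDist (fun hz' => hz (Or.inl (Or.inl hz')))
      (fun hz' => hz (Or.inl (Or.inr hz'))) h _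
  · rintro ((h1 | h1) | h1)
    exacts [notMem_polesQ_of_lt h0.1 h1, notMem_polesV_of_neg h0.2 h1,
      notMem_polesV_of_lt (re_lt_of_strip h0.1) h1]
  · filter_upwards [hμ₀] with μ hm
    rw [sphereDist_of_lt (re_lt_of_strip hm.1), integral_homExt_kernelFamily_of_strip hm.1 hm.2]
  · rintro ((h1 | h1) | h1)
    exacts [hμ h1, hμ' h1, hμ'' h1]

end HomogeneousFourier

open HomogeneousFourier in
theorem proposition2p9 (n : ℕ) :
    (∃ Q : ℂ → smooth n →ₗ[ℂ] smoothEven n, IsKernelFamily n Q) ∧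
    (∃ ι : ∀ ν : ℂ, V n ν →ₗ[ℂ] 𝓢'(E n, ℂ), IsDistributionFamily n ι) ∧
    ∀ (Q : ℂ → smooth n →ₗ[ℂ] smoothEven n) (ι : ∀ ν : ℂ, V n ν →ₗ[ℂ] 𝓢'(E n, ℂ)),
      IsKernelFamily n Q → IsDistributionFamily n ι →
      ∀ μ : ℂ, μ ∉ polesQ n → -μ ∉ polesV n → ∀ h : smoothEven n,
        -- the identity of distributions on `ℝ^N ∖ {0}`
        (∀ φ : 𝓢(E n, ℂ), (0 : E n) ∉ tsupport φ →
          Integrable (fun x : E n => (ext n μ (Q μ h)).1 x * φ x) ∧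
          ∫ x : E n, (ext n μ (Q μ h)).1 x * φ x = C n μ * (𝓕 (ι (-μ) (ext n (-μ) h))) φ) ∧
        -- the identity of tempered distributions on `ℝ^N`
        (μ ∉ polesV n →
          ι μ (ext n μ (Q μ h)) = C n μ • 𝓕 (ι (-μ) (ext n (-μ) h))) := by
  refine ⟨⟨_, isKernelFamily_kernelFamily n⟩, ⟨_, isDistributionFamily_distFamily n⟩,
    fun Q ι hQ hι μ hμ hμ' h => ?_⟩
  rw [hQ.eq_kernelFamily hμ, hι.eq_distFamily hμ']
  refine ⟨fun φ hφ => ⟨?_, integral_homExt_kernelFamily hμ hμ' h hφ⟩, fun hμ'' => ?_⟩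
  · exact integrable_homExt_mul (smooth_continuous (kernelFamily n μ h.1).1)
      φ.continuous.aestronglyMeasurable (integrable_norm_rpow_mul_of_notMem_tsupport φ hφ _)
  · rw [hι.eq_distFamily hμ'']
    ext φ
    exact sphereDist_kernelFamily hμ hμ' hμ'' h φ
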